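/- Let $\mathbb{Z}^2_{even}=\{(x,t)\in\mathbb{Z}^2 : x+t \text{ is even}\}$. The dynamical discrete web is defined as follows. Each site $z\in\mathbb{Z}^2_{even}$ carries an arrow $\xi_z^\tau\in\{-1,+1\}$ that evolves in a dynamical time $\tau\ge 0$: the initial arrow $\xi_z^0$ is uniform on $\{-1,+1\}$, and at each ring of a rate-one Poisson clock attached to $z$ the arrow is reset to a fresh uniform value in $\{-1,+1\}$ (with $\tau\mapsto\xi_z^\tau$ right-continuous). All initial arrows, clocks and reset values, at all sites, are independent. For each $\tau$, let $S_0^\tau$ be the path that starts from $S_0^\tau(0)=0$ and follows the arrows at dynamical time $\tau$, i.e. $S_0^\tau(n+1)=S_0^\tau(n)+\xi^\tau_{(S_0^\tau(n),\,n)}$ for integers $n\ge 0$, interpolated linearly between consecutive integer times. For $K\in(0,\infty)$, a path $\pi:[0,\infty)\to\mathbb{R}$ with $\pi(0)=0$ is called $K^+$-subdiffusive if there exists $j\ge 0$ such that $\pi(t)\ge -j-K\sqrt{t}$ for all $t>0$. Then there exists $K_0\in(0,\infty)$ such that for every $K\ge K_0$, $$\mathbb{P}\big(\exists\,\tau\in[0,1]\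 \text{such that}\ S_0^\tau\ \text{is}\ K^+\text{-subdiffusive}\big)>0,$$ in the sense that this event contains a measurable event of strictly positive probability. -/

import Mathlib

open MeasureTheory ProbabilityTheory

/-- The space-time lattice `ℤ²_even = {(x, t) ∈ ℤ² : x + t even}`. -/
abbrev EvenSite : Type := {z : ℤ × ℤ // Even (z.1 + z.2)}

/-- The space-time origin `(0, 0)`. -/
def EvenSite.origin : EvenSite := ⟨(0, 0), by simp⟩

/-- An arrow is a Boolean: `true` points to the right (increment `+1`),
`false` points to the left (increment `-1`). -/
def increment (b : Bool) : ℤ := if b then 1 else -1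

/-- The endpoint `(x + ξ_{x,t}, t + 1)` of the arrow at `z = (x, t)`. -/
def followArrow (ξ : EvenSite → Bool) (z : EvenSite) : EvenSite :=
  ⟨(z.1.1 + increment (ξ z), z.1.2 + 1), by
    have h := z.2
    cases hb : ξ z <;> simp only [increment] <;> grind⟩

/-- The position, `n` time steps after the start, of the path of the discrete web with arrow
configuration `ξ` that starts from `z`. -/
def webPath (ξ : EvenSite → Bool) (z : EvenSite) (n : ℕ) : ℤ :=
  ((followArrow ξ)^[n] z).1.1

/-- The continuous path in real time `t ≥ 0` which is linear between consecutive integer times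
and takes the values `s n` at integer times. -/
noncomputable def linearInterpolation (s : ℕ → ℤ) (t : ℝ) : ℝ :=
  (s ⌊t⌋₊ : ℝ) + (t - ⌊t⌋₊) * ((s (⌊t⌋₊ + 1) : ℝ) - (s ⌊t⌋₊ : ℝ))

/-- `K⁺`-subdiffusivity of a path (defined for times `t ≥ 0`):
there is `j ≥ 0` with `π t ≥ -j - K √t` for all `t > 0`. -/
def IsPlusSubdiffusive (K : ℝ) (π : ℝ → ℝ) : Prop :=
  ∃ j : ℝ, 0 ≤ j ∧ ∀ t : ℝ, 0 < t → π t ≥ -j - K * √t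

/-- The dynamical discrete web on a probability space `(Ω, P)`. Every site carries a rate one
Poisson clock, given by its i.i.d. exponential waiting times, and i.i.d. fair arrows:
the initial one (index `0`) and the ones to which the site is reset at its successive rings.
All these variables, over all sites, are independent. -/
structure DynamicalDiscreteWeb {Ω : Type*} [MeasurableSpace Ω] (P : Measure Ω) where
  /-- `wait z n` is the waiting time between ring `n` and ring `n + 1` of the clock at `z`
  (from dynamical time `0` to the first ring, if `n = 0`). -/
  wait : EvenSite → ℕ → Ω → ℝ
  /-- `arrow z n` is the direction of the arrow at `z` after `n` rings. -/
  arrow : EvenSite → ℕ → Ω → Bool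
  measurable_wait : ∀ z n, Measurable (wait z n)
  measurable_arrow : ∀ z n, Measurable (arrow z n)
  wait_law : ∀ z n, P.map (wait z n) = expMeasure 1
  arrow_law : ∀ z n b, P {ω | arrow z n ω = b} = 1 / 2
  indep_wait : iIndepFun (fun (i : EvenSite × ℕ) ω => wait i.1 i.2 ω) P
  indep_arrow : iIndepFun (fun (i : EvenSite × ℕ) ω => arrow i.1 i.2 ω) P
  indep_wait_arrow : IndepFun (fun ω (i : EvenSite × ℕ) => wait i.1 i.2 ω)
    (fun ω (i : EvenSite × ℕ) => arrow i.1 i.2 ω) P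

namespace DynamicalDiscreteWeb

variable {Ω : Type*} [MeasurableSpace Ω] {P : Measure Ω} (W : DynamicalDiscreteWeb P)

/-- The dynamical time of the `(n + 1)`-st ring of the clock at `z`. -/
def ringTime (z : EvenSite) (n : ℕ) (ω : Ω) : ℝ :=
  ∑ i ∈ Finset.range (n + 1), W.wait z i ω

/-- The number of rings of the clock at `z` up to and including dynamical time `τ`
(almost surely finite). -/
noncomputable def ringCount (z : EvenSite) (τ : ℝ) (ω : Ω) : ℕ :=
  {n : ℕ | W.ringTime z n ω ≤ τ}.ncard

/-- The arrow configuration at dynamical time `τ`, right continuous in `τ`. -/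
noncomputable def arrowAt (τ : ℝ) (ω : Ω) (z : EvenSite) : Bool :=
  W.arrow z (W.ringCount z τ ω) ω

/-- The path `S_0^τ` from the space-time origin in the web at dynamical time `τ`. -/
noncomputable def originPath (τ : ℝ) (ω : Ω) : ℝ → ℝ :=
  linearInterpolation (webPath (W.arrowAt τ ω) EvenSite.origin)

end DynamicalDiscreteWeb

/-!
Scale `k` covers `(2 ^ (k + 1)) ^ 2` consecutive levels, and its event says that during this time
the walk from a fixed site descends by at most `4 * 2 ^ (k + 1)`. The next scale starts at the
lowest admissible position, and paths of one web are monotone in their starting point, so if all the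
events occur then `S_0^τ` stays above `-8 - 16 √n`.

At a fixed dynamical time the events are independent, with probabilities bounded away from `0`
and `1`. At two dynamical times `τ`, `τ'` the walks interact only when they meet, and the covariance
created by a meeting is at most the squared gradient of the survival probability, hence inversely
proportional to the time left. Since the arrows have correlation `exp (-|τ - τ'|)`, the walks
separate after about `|τ - τ'|⁻¹` meetings, so the probability that the first `n` events occur at
both times is at most `C / √|τ - τ'|` times the square of the probability for one time. This kernel
is integrable, and the second moment method bounds from below, uniformly in `n`, the probability
that some time in `[0, 1]` has the first `n` events.

Compactness gives a limit time as `n → ∞`. The events of this time are those of the approximating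
times unless a site rings at it. The clock of a site is independent of all later scales, so almost
surely infinitely many events fail at each of its rings; this excludes ring times as limits.
-/

/-! ### The sticky lazy walk on `ℤ` -/

/-- The transition operator, acting on functions, of the lazy walk on `ℤ` that makes a step
`-1, 0, 1` with probabilities `1/4, 1/2, 1/4` away from `0`, and `-1, 0, 1` with probabilities
`δ/2, 1 - δ, δ/2` at `0`. For `δ = (1 - ρ) / 2` this is half the difference of two simple random
walks whose steps are independent, except that they have correlation `ρ` when the walks meet. -/
noncomputable def stickyStep (δ : ℝ) : Module.End ℝ (ℤ → ℝ) where
  toFun f d :=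
    if d = 0 then (1 - δ) * f 0 + δ / 2 * (f 1 + f (-1))
    else f (d - 1) / 4 + f d / 2 + f (d + 1) / 4
  map_add' f g := by ext d; simp only [Pi.add_apply]; split_ifs <;> ring
  map_smul' a f := by
    ext d; simp only [Pi.smul_apply, smul_eq_mul, RingHom.id_apply]; split_ifs <;> ring

/-- The probability that the sticky walk started from `d` is at `0` after `n` steps. -/
noncomputable def returnProb (δ : ℝ) (n : ℕ) : ℤ → ℝ :=
  (stickyStep δ ^ n) (Pi.single 0 1)

section StickyWalk

variable {δ : ℝ}

lemma stickyStep_apply_zero (f : ℤ → ℝ) :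
    stickyStep δ f 0 = (1 - δ) * f 0 + δ / 2 * (f 1 + f (-1)) := by
  simp [stickyStep]

lemma stickyStep_apply_of_ne_zero (f : ℤ → ℝ) {d : ℤ} (hd : d ≠ 0) :
    stickyStep δ f d = f (d - 1) / 4 + f d / 2 + f (d + 1) / 4 := by
  simp [stickyStep, hd]

lemma stickyStep_mono (h0 : 0 ≤ δ) (h1 : δ ≤ 1) : Monotone (stickyStep δ) := by
  intro f g h d
  rcases eq_or_ne d 0 with rfl | hd
  · simp only [stickyStep_apply_zero]
    have := sub_nonneg.2 h1
    gcongr <;> apply h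
  · simp only [stickyStep_apply_of_ne_zero _ hd]
    gcongr <;> apply h

lemma sq_stickyStep_le (h0 : 0 ≤ δ) (h1 : δ ≤ 1) (f : ℤ → ℝ) :
    stickyStep δ f ^ 2 ≤ stickyStep δ (f ^ 2) := by
  intro d
  rcases eq_or_ne d 0 with rfl | hd
  · simp only [Pi.pow_apply, stickyStep_apply_zero]
    nlinarith [mul_nonneg h0 (sub_nonneg.2 h1), mul_nonneg (mul_nonneg h0 (sub_nonneg.2 h1))
      (sq_nonneg (2 * f 0 - f 1 - f (-1))), mul_nonneg h0 (sq_nonneg (f 1 - f (-1)))]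
  · simp only [Pi.pow_apply, stickyStep_apply_of_ne_zero _ hd]
    nlinarith [sq_nonneg (f (d - 1) - f d), sq_nonneg (f (d + 1) - f d),
      sq_nonneg (f (d - 1) - f (d + 1))]

lemma stickyStep_abs :
    stickyStep δ (fun d : ℤ => |(d : ℝ)|) = (fun d : ℤ => |(d : ℝ)|) + δ • Pi.single 0 1 := by
  ext d
  rcases lt_trichotomy d 0 with hd | rfl | hd
  · have h : (d : ℝ) ≤ -1 := by exact_mod_cast Int.le_sub_one_of_lt hd
    simp only [stickyStep_apply_of_ne_zero _ hd.ne, Pi.add_apply, Pi.smul_apply,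
      Pi.single_eq_of_ne hd.ne, smul_zero, add_zero]
    push_cast
    rw [abs_of_nonpos (by linarith), abs_of_nonpos (by linarith), abs_of_nonpos (by linarith)]
    ring
  · simp [stickyStep_apply_zero]; ring
  · have h : (1 : ℝ) ≤ d := by exact_mod_cast hd
    simp only [stickyStep_apply_of_ne_zero _ hd.ne', Pi.add_apply, Pi.smul_apply,
      Pi.single_eq_of_ne hd.ne', smul_zero, add_zero]
    push_cast
    rw [abs_of_nonneg (by linarith), abs_of_nonneg (by linarith), abs_of_nonneg (by linarith)]
    ring

lemma stickyStep_sq_add_le (h1 : δ ≤ 1 / 2) (a : ℝ) :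
    stickyStep δ (fun d : ℤ => (d : ℝ) ^ 2 + a) ≤ fun d : ℤ => (d : ℝ) ^ 2 + (a + 1 / 2) := by
  intro d
  rcases eq_or_ne d 0 with rfl | hd
  · simp only [stickyStep_apply_zero]
    push_cast
    linarith
  · simp only [stickyStep_apply_of_ne_zero _ hd]
    push_cast
    linarith

lemma returnProb_zero : returnProb δ 0 = Pi.single 0 1 := rfl

lemma returnProb_succ (n : ℕ) : returnProb δ (n + 1) = stickyStep δ (returnProb δ n) := by
  rw [returnProb, pow_succ', Module.End.mul_apply, returnProb]

lemma returnProb_nonneg (h0 : 0 ≤ δ) (h1 : δ ≤ 1) (n : ℕ) : 0 ≤ returnProb δ n := by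
  induction n with
  | zero => simp [returnProb_zero]
  | succ n ih =>
    rw [returnProb_succ, ← map_zero (stickyStep δ)]
    exact stickyStep_mono h0 h1 ih

lemma returnProb_neg (n : ℕ) (d : ℤ) : returnProb δ n (-d) = returnProb δ n d := by
  induction n generalizing d with
  | zero => simp [returnProb_zero, Pi.single_apply]
  | succ n ih =>
    rcases eq_or_ne d 0 with rfl | hd
    · rw [neg_zero]
    · rw [returnProb_succ, stickyStep_apply_of_ne_zero _ hd,
        stickyStep_apply_of_ne_zero _ (neg_ne_zero.2 hd), ← neg_add', neg_add_eq_sub, ← neg_sub,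
        ih, ih, ih]
      ring

lemma returnProb_antitone_start (h1 : δ ≤ 1 / 2) (n : ℕ) :
    Antitone fun m : ℕ => returnProb δ n m := by
  refine antitone_nat_of_succ_le fun m => ?_
  induction n generalizing m with
  | zero =>
    rw [returnProb_zero, Pi.single_eq_of_ne (by omega)]
    exact (Pi.single_nonneg.2 zero_le_one : (0 : ℤ → ℝ) ≤ _) _
  | succ n ih =>
    rcases m with _ | m
    · have h := ih 0
      have h' := ih 1
      push_cast at h h' ⊢
      rw [returnProb_succ, stickyStep_apply_of_ne_zero _ (by norm_num), stickyStep_apply_zero,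
        returnProb_neg]
      norm_num at h h' ⊢
      nlinarith
    · have h := ih m
      have h' := ih (m + 1)
      have h'' := ih (m + 2)
      push_cast at h h' h'' ⊢
      rw [returnProb_succ, stickyStep_apply_of_ne_zero _ (by omega),
        stickyStep_apply_of_ne_zero _ (by omega), add_sub_cancel_right, add_sub_cancel_right]
      ring_nf at h h' h'' ⊢
      linarith

lemma returnProb_le_zero (h1 : δ ≤ 1 / 2) (n : ℕ) (d : ℤ) :
    returnProb δ n d ≤ returnProb δ n 0 := by
  rcases Int.eq_nat_or_neg d with ⟨m, rfl | rfl⟩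
  · exact returnProb_antitone_start h1 n m.zero_le
  · rw [returnProb_neg]; exact returnProb_antitone_start h1 n m.zero_le

lemma returnProb_antitone_time (h0 : 0 ≤ δ) (h1 : δ ≤ 1 / 2) :
    Antitone fun n => returnProb δ n 0 := by
  refine antitone_nat_of_succ_le fun n => ?_
  rw [returnProb_succ, stickyStep_apply_zero]
  nlinarith [returnProb_le_zero h1 n 1, returnProb_le_zero h1 n (-1)]

/- Tanaka's formula: the expected distance from `0` grows by `δ` per visit to `0`. -/
lemma stickyStep_pow_abs (n : ℕ) :
    (stickyStep δ ^ n) (fun d : ℤ => |(d : ℝ)|) =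
      (fun d : ℤ => |(d : ℝ)|) + δ • ∑ i ∈ Finset.range n, returnProb δ i := by
  induction n with
  | zero => simp
  | succ n ih =>
    rw [pow_succ', Module.End.mul_apply, ih, map_add, map_smul, map_sum, stickyStep_abs,
      Finset.sum_range_succ', smul_add, returnProb_zero]
    simp only [returnProb_succ]
    abel

lemma sq_stickyStep_pow_abs_le (h0 : 0 ≤ δ) (h1 : δ ≤ 1 / 2) (n : ℕ) :
    ((stickyStep δ ^ n) fun d : ℤ => |(d : ℝ)|) ^ 2 ≤ fun d : ℤ => (d : ℝ) ^ 2 + n / 2 := by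
  have h1' : δ ≤ 1 := by linarith
  induction n with
  | zero => intro d; simp
  | succ n ih =>
    rw [pow_succ' (stickyStep δ), Module.End.mul_apply]
    calc _ ≤ _ := sq_stickyStep_le h0 h1' _
      _ ≤ _ := stickyStep_mono h0 h1' ih
      _ ≤ _ := stickyStep_sq_add_le h1 _
      _ = _ := by ext d; push_cast; ring

lemma sum_returnProb_le (h0 : 0 < δ) (h1 : δ ≤ 1 / 2) (n : ℕ) :
    ∑ i ∈ Finset.range n, returnProb δ i 0 ≤ √n / δ := by
  rw [le_div_iff₀ h0]
  refine Real.le_sqrt_of_sq_le ?_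
  have h := sq_stickyStep_pow_abs_le h0.le h1 n 0
  rw [stickyStep_pow_abs] at h
  simp only [Pi.pow_apply, Pi.add_apply, Pi.smul_apply, Finset.sum_apply, Int.cast_zero, abs_zero,
    zero_add, smul_eq_mul, ne_eq, OfNat.ofNat_ne_zero, not_false_eq_true, zero_pow] at h
  rw [mul_comm]
  linarith [n.cast_nonneg (α := ℝ)]

lemma sq_returnProb_le (h0 : 0 < δ) (h1 : δ ≤ 1 / 2) (n : ℕ) :
    returnProb δ n 0 ^ 2 ≤ 1 / (δ ^ 2 * (n + 1)) := by
  have hn : (0 : ℝ) < n + 1 := by positivity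
  have hcard : (n + 1) * returnProb δ n 0 ≤ √(n + 1) / δ := by
    have h := Finset.card_nsmul_le_sum (Finset.range (n + 1)) (fun i => returnProb δ i 0)
      (returnProb δ n 0) fun i hi => returnProb_antitone_time h0.le h1
        (Nat.lt_succ_iff.1 (Finset.mem_range.1 hi))
    simpa using h.trans (sum_returnProb_le h0 h1 (n + 1))
  calc returnProb δ n 0 ^ 2 = ((n + 1) * returnProb δ n 0) ^ 2 / (n + 1) ^ 2 := by field_simp
    _ ≤ (√(n + 1) / δ) ^ 2 / (n + 1) ^ 2 := by
      gcongr
      exact mul_nonneg hn.le (returnProb_nonneg h0.le (by linarith) n 0)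
    _ = 1 / (δ ^ 2 * (n + 1)) := by
      rw [div_pow, Real.sq_sqrt hn.le]
      field_simp

end StickyWalk

lemma stickyStep_half_apply (f : ℤ → ℝ) (d : ℤ) :
    stickyStep (1 / 2) f d = f (d - 1) / 4 + f d / 2 + f (d + 1) / 4 := by
  rcases eq_or_ne d 0 with rfl | hd
  · rw [stickyStep_apply_zero]; norm_num; ring
  · exact stickyStep_apply_of_ne_zero f hd

/-! ### One walk staying nonnegative -/

/-- The probability that the simple random walk from `x` is nonnegative at times `0, …, s`. -/
noncomputable def stayProb : ℕ → ℤ → ℝ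
  | 0, x => if 0 ≤ x then 1 else 0
  | s + 1, x => if 0 ≤ x then (stayProb s (x + 1) + stayProb s (x - 1)) / 2 else 0

lemma stayProb_of_neg (s : ℕ) {x : ℤ} (hx : x < 0) : stayProb s x = 0 := by
  cases s <;> simp [stayProb, hx.not_ge]

lemma stayProb_zero {x : ℤ} (hx : 0 ≤ x) : stayProb 0 x = 1 := by
  simp [stayProb, hx]

lemma stayProb_succ (s : ℕ) {x : ℤ} (hx : 0 ≤ x) :
    stayProb (s + 1) x = (stayProb s (x + 1) + stayProb s (x - 1)) / 2 := by
  simp [stayProb, hx]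

lemma stayProb_mem_Icc (s : ℕ) (x : ℤ) : stayProb s x ∈ Set.Icc 0 1 := by
  induction s generalizing x with
  | zero => simp only [stayProb]; split_ifs <;> simp
  | succ s ih =>
    rcases lt_or_ge x 0 with hx | hx
    · simp [stayProb_of_neg _ hx]
    · rw [stayProb_succ _ hx]
      constructor <;> linarith [(ih (x + 1)).1, (ih (x + 1)).2, (ih (x - 1)).1, (ih (x - 1)).2]

lemma stayProb_nonneg (s : ℕ) (x : ℤ) : 0 ≤ stayProb s x := (stayProb_mem_Icc s x).1

lemma stayProb_le_one (s : ℕ) (x : ℤ) : stayProb s x ≤ 1 := (stayProb_mem_Icc s x).2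

lemma stayProb_antitone (x : ℤ) : Antitone fun s => stayProb s x := by
  refine antitone_nat_of_succ_le fun s => ?_
  induction s generalizing x with
  | zero =>
    rcases lt_or_ge x 0 with hx | hx
    · simp only [stayProb_of_neg _ hx, le_refl]
    · exact (stayProb_le_one _ _).trans_eq (stayProb_zero hx).symm
  | succ s ih =>
    rcases lt_or_ge x 0 with hx | hx
    · simp only [stayProb_of_neg _ hx, le_refl]
    · rw [stayProb_succ _ hx, stayProb_succ _ hx]; linarith [ih (x + 1), ih (x - 1)]

lemma stayProb_mono (s : ℕ) : Monotone (stayProb s) := by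
  refine monotone_int_of_le_succ fun x => ?_
  rcases lt_or_ge x 0 with hx | hx
  · rw [stayProb_of_neg _ hx]; exact stayProb_nonneg _ _
  induction s generalizing x with
  | zero => rw [stayProb_zero hx, stayProb_zero (by omega)]
  | succ s ih =>
    rw [stayProb_succ _ hx, stayProb_succ _ (by omega), add_sub_cancel_right]
    have hleft : stayProb s (x - 1) ≤ stayProb s x := by
      rcases hx.eq_or_lt with rfl | hx
      · rw [stayProb_of_neg _ (by norm_num)]; exact stayProb_nonneg _ _
      · simpa using ih (x - 1) (by omega)
    linarith [ih (x + 1) (by omega)]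

/- Kolmogorov's inequality for the walk from `x`, centred at an arbitrary `L`. -/
lemma one_sub_stayProb_le (L s : ℕ) {x : ℤ} (hx : -1 ≤ x) :
    1 - stayProb s x ≤ (((x : ℝ) - L) ^ 2 + s) / (L + 1) ^ 2 := by
  have hL : (0 : ℝ) < ((L : ℝ) + 1) ^ 2 := by positivity
  have hneg : ∀ s : ℕ, 1 - stayProb s (-1) ≤ ((((-1 : ℤ) : ℝ) - L) ^ 2 + s) / (L + 1) ^ 2 := by
    intro s
    rw [stayProb_of_neg _ (by norm_num), le_div_iff₀ hL]
    push_cast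
    linarith [s.cast_nonneg (α := ℝ)]
  induction s generalizing x with
  | zero =>
    rcases hx.eq_or_lt with rfl | hx
    · exact hneg 0
    · rw [stayProb_zero (by omega), sub_self]; positivity
  | succ s ih =>
    rcases hx.eq_or_lt with rfl | hx
    · exact hneg (s + 1)
    · have hright := ih (x := x + 1) (by omega)
      have hleft := ih (x := x - 1) (by omega)
      rw [stayProb_succ _ (by omega)]
      rw [le_div_iff₀ hL] at *
      push_cast at *
      nlinarith

/-- The odd extension about `-1` of the probability of staying nonnegative. By the reflection
principle it solves the discrete heat equation on all of `ℤ`. -/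
noncomputable def oddStay : ℕ → ℤ → ℝ
  | 0, x => if 0 ≤ x then 1 else if x = -1 then 0 else -1
  | s + 1, x => (oddStay s (x + 1) + oddStay s (x - 1)) / 2

lemma oddStay_succ (s : ℕ) (x : ℤ) :
    oddStay (s + 1) x = (oddStay s (x + 1) + oddStay s (x - 1)) / 2 := rfl

lemma oddStay_reflect (s : ℕ) (x : ℤ) : oddStay s (-2 - x) = -oddStay s x := by
  induction s generalizing x with
  | zero => simp only [oddStay]; split_ifs <;> first | omega | norm_num
  | succ s ih =>
    rw [oddStay_succ, oddStay_succ, show -2 - x + 1 = -2 - (x - 1) by ring,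
      show -2 - x - 1 = -2 - (x + 1) by ring, ih, ih]
    ring

lemma stayProb_eq_oddStay (s : ℕ) {x : ℤ} (hx : -1 ≤ x) : stayProb s x = oddStay s x := by
  induction s generalizing x with
  | zero => simp only [stayProb, oddStay]; split_ifs <;> first | omega | rfl
  | succ s ih =>
    rcases hx.eq_or_lt with rfl | hx
    · rw [stayProb_of_neg _ (by norm_num)]
      have h := oddStay_reflect (s + 1) (-1)
      norm_num at h
      linarith
    · rw [stayProb_succ _ (by omega), oddStay_succ, ih (by omega), ih (by omega)]

lemma oddStay_add_two (s : ℕ) (x : ℤ) :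
    oddStay (s + 2) x = oddStay s (x - 2) / 4 + oddStay s x / 2 + oddStay s (x + 2) / 4 := by
  rw [oddStay_succ, oddStay_succ, oddStay_succ]
  ring_nf

/- Two steps of the simple random walk are one lazy step, so the discrete derivative of `oddStay`
is a transition probability of the lazy walk; its shape depends on the parity of the position. -/
lemma oddStay_sub_odd (n : ℕ) (d : ℤ) :
    oddStay (2 * n) (2 * d) - oddStay (2 * n) (2 * d - 2) = 2 * returnProb (1 / 2) n d := by
  induction n generalizing d with
  | zero =>
    simp only [oddStay, returnProb_zero, Pi.single_apply]
    split_ifs <;> first | omega | norm_num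
  | succ n ih =>
    rw [returnProb_succ, stickyStep_half_apply, mul_add_one, oddStay_add_two, oddStay_add_two]
    linear_combination (norm := ring_nf) ih (d - 1) / 4 + ih d / 2 + ih (d + 1) / 4

lemma oddStay_sub_even (n : ℕ) (d : ℤ) :
    oddStay (2 * n) (2 * d + 1) - oddStay (2 * n) (2 * d - 1) =
      returnProb (1 / 2) n d + returnProb (1 / 2) n (d + 1) := by
  induction n generalizing d with
  | zero =>
    simp only [oddStay, returnProb_zero, Pi.single_apply]
    split_ifs <;> first | omega | norm_num
  | succ n ih =>
    rw [returnProb_succ, stickyStep_half_apply, stickyStep_half_apply, mul_add_one,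
      oddStay_add_two, oddStay_add_two]
    linear_combination (norm := ring_nf) ih (d - 1) / 4 + ih d / 2 + ih (d + 1) / 4

lemma oddStay_sub_le (s : ℕ) (x : ℤ) :
    oddStay s (x + 1) - oddStay s (x - 1) ≤ 2 * returnProb (1 / 2) (s / 2) 0 := by
  have heven : ∀ n x, oddStay (2 * n) (x + 1) - oddStay (2 * n) (x - 1) ≤
      2 * returnProb (1 / 2) n 0 := by
    intro n x
    rcases Int.even_or_odd' x with ⟨d, rfl | rfl⟩
    · rw [oddStay_sub_even]
      linarith [returnProb_le_zero (δ := 1 / 2) le_rfl n d,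
        returnProb_le_zero (δ := 1 / 2) le_rfl n (d + 1)]
    · have h := oddStay_sub_odd n (d + 1)
      rw [show 2 * d + 1 + 1 = 2 * (d + 1) by ring, show 2 * d + 1 - 1 = 2 * (d + 1) - 2 by ring]
      linarith [returnProb_le_zero (δ := 1 / 2) le_rfl n (d + 1)]
  rcases Nat.even_or_odd' s with ⟨n, rfl | rfl⟩
  · simpa using heven n x
  · rw [show (2 * n + 1) / 2 = n by omega, oddStay_succ, oddStay_succ]
    have hright := heven n (x + 1)
    have hleft := heven n (x - 1)
    rw [show x + 1 - 1 = x - 1 + 1 by ring] at *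
    linarith

lemma sq_stayProb_gradient_le (s : ℕ) {x : ℤ} (hx : 0 ≤ x) :
    ((stayProb s (x + 1) - stayProb s (x - 1)) / 2) ^ 2 ≤ 8 / (s + 1) := by
  have hnonneg : 0 ≤ stayProb s (x + 1) - stayProb s (x - 1) :=
    sub_nonneg.2 (stayProb_mono s (by omega))
  have hle : stayProb s (x + 1) - stayProb s (x - 1) ≤ 2 * returnProb (1 / 2) (s / 2) 0 := by
    rw [stayProb_eq_oddStay _ (by omega), stayProb_eq_oddStay _ (by omega)]
    exact oddStay_sub_le s x
  calc ((stayProb s (x + 1) - stayProb s (x - 1)) / 2) ^ 2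
      ≤ returnProb (1 / 2) (s / 2) 0 ^ 2 := pow_le_pow_left₀ (by linarith) (by linarith) 2
    _ ≤ 1 / ((1 / 2) ^ 2 * ((s / 2 : ℕ) + 1)) := sq_returnProb_le (by norm_num) le_rfl _
    _ ≤ 8 / (s + 1) := by
      rw [div_le_div_iff₀ (by positivity) (by positivity)]
      have : (s : ℝ) ≤ 2 * ((s / 2 : ℕ) : ℝ) + 1 := by
        exact_mod_cast (by omega : s ≤ 2 * (s / 2) + 1)
      linarith

lemma stayProb_le_mul (s m : ℕ) : stayProb s m ≤ (m + 1) * (6 / √(s + 1)) := by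
  have hs : (0 : ℝ) < s + 1 := by positivity
  have hstep : ∀ x : ℤ, 0 ≤ x → stayProb s x ≤ stayProb s (x - 1) + 6 / √(s + 1) := by
    intro x hx
    have hgrad : (stayProb s (x + 1) - stayProb s (x - 1)) / 2 ≤ 3 / √(s + 1) := by
      refine le_of_sq_le_sq ((sq_stayProb_gradient_le s hx).trans ?_) (by positivity)
      rw [div_pow, Real.sq_sqrt hs.le]
      gcongr; norm_num
    have hmono : stayProb s x ≤ stayProb s (x + 1) := stayProb_mono s (by omega)
    linear_combination 2 * hgrad + hmono
  induction m with
  | zero =>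
    have h := hstep 0 le_rfl
    rw [stayProb_of_neg s (show (0 : ℤ) - 1 < 0 by norm_num)] at h
    simpa using h
  | succ m ih =>
    have h := hstep (m + 1) (by positivity)
    rw [add_sub_cancel_right] at h
    push_cast
    linarith

lemma stayProb_le_half {s m : ℕ} (h : (12 * (m + 1)) ^ 2 ≤ s) : stayProb s m ≤ 1 / 2 := by
  have hs : 12 * ((m : ℝ) + 1) ≤ √(s + 1) :=
    Real.le_sqrt_of_sq_le (by exact_mod_cast h.trans s.le_succ)
  refine (stayProb_le_mul s m).trans ?_
  rw [mul_div_assoc', div_le_iff₀ (by positivity)]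
  linarith

/- To descend `x + y + 2` levels it is enough to descend `x + 1` and then `y + 1` levels. -/
lemma one_sub_stayProb_mul_le (s t : ℕ) {x : ℤ} (y : ℤ) (hx : -1 ≤ x) :
    (1 - stayProb s x) * (1 - stayProb t y) ≤ 1 - stayProb (s + t) (x + y + 1) := by
  induction s generalizing x with
  | zero =>
    rcases hx.eq_or_lt with rfl | hx
    · simp [stayProb_of_neg]
    · simp [stayProb_zero (show 0 ≤ x by omega), stayProb_le_one]
  | succ s ih =>
    rcases hx.eq_or_lt with rfl | hx
    · rw [stayProb_of_neg _ (by norm_num), neg_add_cancel_comm]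
      linarith [stayProb_antitone y (show t ≤ s + 1 + t by omega)]
    · have hright := ih (x := x + 1) (by omega)
      have hleft := ih (x := x - 1) (by omega)
      rw [stayProb_succ _ (by omega)]
      rcases lt_or_ge (x + y + 1) 0 with hneg | hnonneg
      · rw [stayProb_of_neg _ hneg]
        nlinarith [stayProb_nonneg s (x + 1), stayProb_nonneg s (x - 1), stayProb_nonneg t y,
          stayProb_le_one s (x + 1), stayProb_le_one s (x - 1), stayProb_le_one t y]
      · rw [Nat.add_right_comm, stayProb_succ _ hnonneg]
        rw [show x + 1 + y + 1 = x + y + 1 + 1 by ring] at hright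
        rw [show x - 1 + y + 1 = x + y + 1 - 1 by ring] at hleft
        linarith

lemma one_sub_stayProb_pow_le (s m M : ℕ) :
    (1 - stayProb s m) ^ M ≤ 1 - stayProb (M * s) (M * (m + 1) - 1) := by
  induction M with
  | zero => simp [stayProb_of_neg]
  | succ M ih =>
    have hM : (-1 : ℤ) ≤ M * (m + 1) - 1 := by linarith [show (0 : ℤ) ≤ M * (m + 1) by positivity]
    calc (1 - stayProb s m) ^ (M + 1)
        ≤ (1 - stayProb (M * s) (M * (m + 1) - 1)) * (1 - stayProb s m) := by
          rw [pow_succ]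
          exact mul_le_mul_of_nonneg_right ih (sub_nonneg.2 (stayProb_le_one s m))
      _ ≤ 1 - stayProb (M * s + s) (M * (m + 1) - 1 + m + 1) := one_sub_stayProb_mul_le _ _ _ hM
      _ = 1 - stayProb ((M + 1 : ℕ) * s) ((M + 1 : ℕ) * (m + 1) - 1) := by
          rw [Nat.succ_mul]; push_cast; ring_nf

lemma exists_stayProb_sq_le (c : ℕ) :
    ∃ q < 1, ∀ᶠ n in Filter.atTop, stayProb (n ^ 2) (c * n : ℕ) ≤ q := by
  obtain ⟨A, hA⟩ : ∃ A, A = 24 * (c + 1) := ⟨_, rfl⟩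
  refine ⟨1 - (1 / 2) ^ (A ^ 2), by simp, Filter.eventually_atTop.2 ⟨12 * A, fun n hn => ?_⟩⟩
  -- a descent of `i + 1` in each of `A ^ 2` blocks of length `(12 * (i + 1)) ^ 2` is enough
  obtain ⟨i, hi⟩ : ∃ i, n / (12 * A) = i + 1 :=
    Nat.exists_eq_succ_of_ne_zero (Nat.div_pos hn (by omega)).ne'
  have hlow : 12 * A * (i + 1) ≤ n := hi ▸ Nat.mul_div_le n _
  have hup : n ≤ 24 * A * (i + 1) := by
    have := Nat.lt_mul_div_succ n (show 0 < 12 * A by omega)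
    rw [hi] at this
    nlinarith
  have htime : A ^ 2 * (12 * (i + 1)) ^ 2 ≤ n ^ 2 := by
    rw [← mul_pow]
    exact Nat.pow_le_pow_left (le_of_eq_of_le (by ring) hlow) 2
  have hdepth : ((c * n : ℕ) : ℤ) ≤ (A ^ 2 : ℕ) * (i + 1) - 1 := by
    have : c * n + 1 ≤ A ^ 2 * (i + 1) := by nlinarith [Nat.mul_le_mul_left c hup]
    zify at this ⊢
    linarith
  have hblock := one_sub_stayProb_pow_le ((12 * (i + 1)) ^ 2) i (A ^ 2)
  calc stayProb (n ^ 2) (c * n : ℕ)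
      ≤ stayProb (A ^ 2 * (12 * (i + 1)) ^ 2) ((A ^ 2 : ℕ) * (i + 1) - 1) :=
        (stayProb_antitone _ htime).trans (stayProb_mono _ hdepth)
    _ ≤ 1 - (1 - stayProb ((12 * (i + 1)) ^ 2) i) ^ (A ^ 2) := by linarith
    _ ≤ 1 - (1 / 2) ^ (A ^ 2) := by
        gcongr
        linarith [stayProb_le_half (le_refl ((12 * (i + 1)) ^ 2))]

/-! ### Two walks in correlated webs -/

/-- The correlation `ρ` if `x = y`, and no correlation otherwise: the correlation of the arrows
that two walks in correlated webs meet at the positions `x` and `y`. -/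
def diagCorr {α : Type*} [DecidableEq α] (ρ : ℝ) (x y : α) : ℝ := if x = y then ρ else 0

lemma abs_diagCorr_le_one {α : Type*} [DecidableEq α] {ρ : ℝ} (hρ : |ρ| ≤ 1) (x y : α) :
    |diagCorr ρ x y| ≤ 1 := by
  unfold diagCorr; split_ifs <;> simp [hρ]

/-- The probability that the walks from `x` and `y` are both nonnegative at times `0, …, s`, when
their steps are independent while they are apart and have correlation `ρ` while they are
together. -/
noncomputable def pairStayProb (ρ : ℝ) : ℕ → ℤ → ℤ → ℝ
  | 0, x, y => if 0 ≤ x ∧ 0 ≤ y then 1 else 0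
  | s + 1, x, y =>
    if 0 ≤ x ∧ 0 ≤ y then
      (1 + diagCorr ρ x y) / 4 *
        (pairStayProb ρ s (x + 1) (y + 1) + pairStayProb ρ s (x - 1) (y - 1)) +
      (1 - diagCorr ρ x y) / 4 *
        (pairStayProb ρ s (x + 1) (y - 1) + pairStayProb ρ s (x - 1) (y + 1))
    else 0

/-- The expected sum, over the times before `s` at which two walks at initial distance `2 * d`
meet, of `8` divided by the time left: a bound for the covariance that the meetings create. -/
noncomputable def meetingBound (δ : ℝ) (s : ℕ) : ℤ → ℝ :=
  ∑ i ∈ Finset.range s, (8 / ((s - i : ℕ) : ℝ)) • returnProb δ i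

lemma meetingBound_succ (δ : ℝ) (s : ℕ) :
    meetingBound δ (s + 1) =
      stickyStep δ (meetingBound δ s) + (8 / ((s : ℝ) + 1)) • Pi.single 0 1 := by
  simp only [meetingBound, Finset.sum_range_succ', returnProb_succ, returnProb_zero,
    Nat.add_sub_add_right, Nat.sub_zero, Nat.cast_add_one, map_sum, map_smul]

lemma meetingBound_nonneg {δ : ℝ} (h0 : 0 ≤ δ) (h1 : δ ≤ 1) (s : ℕ) : 0 ≤ meetingBound δ s :=
  Finset.sum_nonneg fun i _ => smul_nonneg (by positivity) (returnProb_nonneg h0 h1 i)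

lemma sum_range_div_le_log (n : ℕ) :
    ∑ i ∈ Finset.range n, 8 / ((n - i : ℕ) : ℝ) ≤ 8 * (1 + Real.log n) := by
  have h := harmonic_le_one_add_log n
  rw [harmonic, ← Finset.sum_range_reflect] at h
  push_cast at h
  calc ∑ i ∈ Finset.range n, 8 / ((n - i : ℕ) : ℝ)
      = 8 * ∑ i ∈ Finset.range n, (((n - 1 - i : ℕ) : ℝ) + 1)⁻¹ := by
        rw [Finset.mul_sum]
        refine Finset.sum_congr rfl fun i hi => ?_
        rw [div_eq_mul_inv, ← Nat.cast_add_one,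
          show n - 1 - i + 1 = n - i by have := Finset.mem_range.1 hi; omega]
    _ ≤ 8 * (1 + Real.log n) := by gcongr

/- Chebyshev's sum inequality: late meetings, with a small time left, are the least likely. -/
lemma meetingBound_zero_le {δ : ℝ} (h0 : 0 < δ) (h1 : δ ≤ 1 / 2) {n : ℕ} (hn : 0 < n) :
    meetingBound δ n 0 ≤ 8 * (1 + Real.log n) / (√n * δ) := by
  have hn' : (0 : ℝ) < n := by exact_mod_cast hn
  have hanti : AntivaryOn (fun i => 8 / ((n - i : ℕ) : ℝ)) (fun i => returnProb δ i 0)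
      (Finset.range n : Set ℕ) := by
    refine MonotoneOn.antivaryOn ?_ ((returnProb_antitone_time h0.le h1).antitoneOn _)
    intro i _ j hj hij
    have : 0 < n - j := by have := Finset.mem_range.1 hj; omega
    dsimp only
    gcongr
  have hprod : n * meetingBound δ n 0 ≤ 8 * (1 + Real.log n) * (√n / δ) := by
    calc n * meetingBound δ n 0
        = n * ∑ i ∈ Finset.range n, 8 / ((n - i : ℕ) : ℝ) * returnProb δ i 0 := by
          simp [meetingBound, Finset.sum_apply]
      _ ≤ (∑ i ∈ Finset.range n, 8 / ((n - i : ℕ) : ℝ)) *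
            ∑ i ∈ Finset.range n, returnProb δ i 0 := by
          simpa using hanti.card_mul_sum_le_sum_mul_sum
      _ ≤ 8 * (1 + Real.log n) * (√n / δ) := by
          have := Finset.sum_nonneg fun i (_ : i ∈ Finset.range n) =>
            returnProb_nonneg h0.le (by linarith) i 0
          have := Real.log_natCast_nonneg n
          gcongr
          · exact sum_range_div_le_log n
          · exact sum_returnProb_le h0 h1 n
  refine le_of_mul_le_mul_left (hprod.trans_eq ?_) hn'
  have hsqrt : √(n : ℝ) ≠ 0 := (Real.sqrt_pos.2 hn').ne'
  field_simp
  rw [Real.sq_sqrt hn'.le]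

section PairStayProb

variable {ρ : ℝ}

lemma pairStayProb_succ (s : ℕ) {x y : ℤ} (hx : 0 ≤ x) (hy : 0 ≤ y) :
    pairStayProb ρ (s + 1) x y =
      (1 + diagCorr ρ x y) / 4 *
        (pairStayProb ρ s (x + 1) (y + 1) + pairStayProb ρ s (x - 1) (y - 1)) +
      (1 - diagCorr ρ x y) / 4 *
        (pairStayProb ρ s (x + 1) (y - 1) + pairStayProb ρ s (x - 1) (y + 1)) := by
  rw [pairStayProb, if_pos ⟨hx, hy⟩]

lemma pairStayProb_zero {x y : ℤ} (hx : 0 ≤ x) (hy : 0 ≤ y) : pairStayProb ρ 0 x y = 1 := by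
  rw [pairStayProb, if_pos ⟨hx, hy⟩]

lemma pairStayProb_of_neg (s : ℕ) {x y : ℤ} (h : ¬(0 ≤ x ∧ 0 ≤ y)) :
    pairStayProb ρ s x y = 0 := by
  cases s <;> rw [pairStayProb, if_neg h]

lemma pairStayProb_one (s : ℕ) (x : ℤ) : pairStayProb 1 s x x = stayProb s x := by
  rcases lt_or_ge x 0 with hx | hx
  · rw [stayProb_of_neg _ hx, pairStayProb_of_neg _ fun h => h.1.not_gt hx]
  induction s generalizing x with
  | zero => rw [pairStayProb_zero hx hx, stayProb_zero hx]
  | succ s ih =>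
    have ih' : ∀ z, pairStayProb 1 s z z = stayProb s z := fun z => by
      rcases lt_or_ge z 0 with hz | hz
      · rw [stayProb_of_neg _ hz, pairStayProb_of_neg _ fun h => h.1.not_gt hz]
      · exact ih z hz
    rw [pairStayProb_succ _ hx hx, stayProb_succ _ hx, diagCorr, if_pos rfl, ih', ih']
    ring

lemma pairStayProb_nonneg (hρ : |ρ| ≤ 1) (s : ℕ) (x y : ℤ) : 0 ≤ pairStayProb ρ s x y := by
  induction s generalizing x y with
  | zero => unfold pairStayProb; split_ifs <;> norm_num
  | succ s ih =>
    obtain ⟨hlow, hup⟩ := abs_le.1 (abs_diagCorr_le_one hρ x y)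
    unfold pairStayProb
    split_ifs
    · exact add_nonneg (mul_nonneg (by linarith) (add_nonneg (ih _ _) (ih _ _)))
        (mul_nonneg (by linarith) (add_nonneg (ih _ _) (ih _ _)))
    · rfl

lemma pairStayProb_le_stayProb (hρ : |ρ| ≤ 1) (s : ℕ) (x y : ℤ) :
    pairStayProb ρ s x y ≤ stayProb s x := by
  by_cases hxy : 0 ≤ x ∧ 0 ≤ y
  swap
  · rw [pairStayProb_of_neg s hxy]; exact stayProb_nonneg _ _
  induction s generalizing x y with
  | zero => rw [pairStayProb_zero hxy.1 hxy.2, stayProb_zero hxy.1]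
  | succ s ih =>
    have ih' : ∀ x y, pairStayProb ρ s x y ≤ stayProb s x := fun x y => by
      by_cases hxy : 0 ≤ x ∧ 0 ≤ y
      · exact ih x y hxy
      · rw [pairStayProb_of_neg s hxy]; exact stayProb_nonneg _ _
    obtain ⟨hlow, hup⟩ := abs_le.1 (abs_diagCorr_le_one hρ x y)
    rw [pairStayProb_succ _ hxy.1 hxy.2, stayProb_succ _ hxy.1]
    have hagree := mul_le_mul_of_nonneg_left (add_le_add (ih' (x + 1) (y + 1))
      (ih' (x - 1) (y - 1))) (by linarith : 0 ≤ (1 + diagCorr ρ x y) / 4)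
    have hdiffer := mul_le_mul_of_nonneg_left (add_le_add (ih' (x + 1) (y - 1))
      (ih' (x - 1) (y + 1))) (by linarith : 0 ≤ (1 - diagCorr ρ x y) / 4)
    linarith

/- While the walks are apart their covariance is transported; each meeting increases it by at most
the squared gradient of `stayProb`. -/
lemma pairStayProb_le (h0 : 0 ≤ ρ) (h1 : ρ ≤ 1) (s : ℕ) (y d : ℤ) :
    pairStayProb ρ s (y + 2 * d) y ≤
      stayProb s (y + 2 * d) * stayProb s y + meetingBound ((1 - ρ) / 2) s d := by
  set δ := (1 - ρ) / 2 with hδ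
  by_cases hxy : 0 ≤ y + 2 * d ∧ 0 ≤ y
  swap
  · rw [pairStayProb_of_neg s hxy]
    exact add_nonneg (mul_nonneg (stayProb_nonneg _ _) (stayProb_nonneg _ _))
      (meetingBound_nonneg (by linarith) (by linarith) s d)
  induction s generalizing y d with
  | zero => simp [pairStayProb_zero, stayProb_zero, meetingBound, hxy]
  | succ s ih =>
    have ih' : ∀ x y d, x = y + 2 * d →
        pairStayProb ρ s x y ≤ stayProb s x * stayProb s y + meetingBound δ s d := by
      rintro _ y d rfl
      by_cases hxy : 0 ≤ y + 2 * d ∧ 0 ≤ y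
      · exact ih y d hxy
      · rw [pairStayProb_of_neg s hxy]
        exact add_nonneg (mul_nonneg (stayProb_nonneg _ _) (stayProb_nonneg _ _))
          (meetingBound_nonneg (by linarith) (by linarith) s d)
    have pp := ih' (y + 2 * d + 1) (y + 1) d (by ring)
    have mm := ih' (y + 2 * d - 1) (y - 1) d (by ring)
    have pm := ih' (y + 2 * d + 1) (y - 1) (d + 1) (by ring)
    have mp := ih' (y + 2 * d - 1) (y + 1) (d - 1) (by ring)
    rw [pairStayProb_succ _ hxy.1 hxy.2, stayProb_succ _ hxy.1, stayProb_succ _ hxy.2,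
      meetingBound_succ, Pi.add_apply, Pi.smul_apply]
    rcases eq_or_ne d 0 with rfl | hd
    · have hgrad := mul_le_mul_of_nonneg_left (sq_stayProb_gradient_le s hxy.2) h0
      have hgrad' := mul_le_of_le_one_left (show (0 : ℝ) ≤ 8 / (s + 1) by positivity) h1
      rw [stickyStep_apply_zero, Pi.single_eq_same]
      simp only [mul_zero, add_zero, zero_add, zero_sub, diagCorr, if_true, smul_eq_mul,
        mul_one] at *
      linear_combination (1 + ρ) / 4 * (pp + mm) + (1 - ρ) / 4 * (pm + mp) + hgrad + hgrad'
    · rw [stickyStep_apply_of_ne_zero _ hd, Pi.single_eq_of_ne hd, diagCorr, if_neg (by omega)]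
      simp only [smul_eq_mul, mul_zero, add_zero]
      linear_combination (pp + mm + pm + mp) / 4

lemma pairStayProb_self_le (h0 : 0 ≤ ρ) (h1 : ρ < 1) {n : ℕ} (hn : 0 < n) (x : ℤ) :
    pairStayProb ρ n x x ≤ stayProb n x ^ 2 + 16 * (1 + Real.log n) / (√n * (1 - ρ)) := by
  have hpair := pairStayProb_le h0 h1.le n x 0
  have hmeet := meetingBound_zero_le (δ := (1 - ρ) / 2) (by linarith) (by linarith) hn
  rw [mul_zero, add_zero, ← sq] at hpair
  refine hpair.trans ((add_le_add_right hmeet _).trans_eq ?_)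
  have : 1 - ρ ≠ 0 := by linarith
  field_simp
  ring

end PairStayProb

/-! ### The scales -/

section ProductBound

variable {p v : ℕ → ℝ} {a r C Δ : ℝ}

lemma prod_le_inv_pow_mul_sq_prod (ha : 0 < a) (hp : ∀ k, a ≤ p k) (hv0 : ∀ k, 0 ≤ v k)
    (hvp : ∀ k, v k ≤ p k) (n : ℕ) :
    ∏ k ∈ Finset.range n, v k ≤ a⁻¹ ^ n * (∏ k ∈ Finset.range n, p k) ^ 2 := by
  calc ∏ k ∈ Finset.range n, v k ≤ ∏ k ∈ Finset.range n, (a⁻¹ * p k ^ 2) := by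
        refine Finset.prod_le_prod (fun k _ => hv0 k) fun k _ => (hvp k).trans ?_
        rw [inv_mul_eq_div, le_div_iff₀ ha, sq]
        exact mul_le_mul_of_nonneg_left (hp k) (ha.le.trans (hp k))
    _ = a⁻¹ ^ n * (∏ k ∈ Finset.range n, p k) ^ 2 := by
        rw [Finset.prod_mul_distrib, Finset.prod_const, Finset.card_range, Finset.prod_pow]

lemma prod_le_exp_mul_sq_prod (ha : 0 < a) (hr0 : 0 ≤ r) (hr1 : r < 1) (hC : 0 ≤ C)
    (hp : ∀ k, a ≤ p k) (hv0 : ∀ k, 0 ≤ v k) (hv : ∀ k, v k ≤ p k ^ 2 + C * r ^ k) (n : ℕ) :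
    ∏ k ∈ Finset.range n, v k ≤
      Real.exp (C / a ^ 2 / (1 - r)) * (∏ k ∈ Finset.range n, p k) ^ 2 := by
  have hfactor : ∀ k, v k ≤ Real.exp (C / a ^ 2 * r ^ k) * p k ^ 2 := fun k => by
    have hsq : a ^ 2 ≤ p k ^ 2 := pow_le_pow_left₀ ha.le (hp k) 2
    calc v k ≤ p k ^ 2 + C * r ^ k := hv k
      _ = C / a ^ 2 * r ^ k * a ^ 2 + p k ^ 2 := by field_simp; ring
      _ ≤ C / a ^ 2 * r ^ k * p k ^ 2 + p k ^ 2 := by gcongr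
      _ = (C / a ^ 2 * r ^ k + 1) * p k ^ 2 := by ring
      _ ≤ Real.exp (C / a ^ 2 * r ^ k) * p k ^ 2 := by
        gcongr; exact Real.add_one_le_exp _
  have hgeom : ∑ k ∈ Finset.range n, r ^ k ≤ (1 - r)⁻¹ := by
    rw [← tsum_geometric_of_lt_one hr0 hr1]
    exact (summable_geometric_of_lt_one hr0 hr1).sum_le_tsum _ fun k _ => pow_nonneg hr0 k
  calc ∏ k ∈ Finset.range n, v k
      ≤ ∏ k ∈ Finset.range n, (Real.exp (C / a ^ 2 * r ^ k) * p k ^ 2) :=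
        Finset.prod_le_prod (fun k _ => hv0 k) fun k _ => hfactor k
    _ = Real.exp (C / a ^ 2 * ∑ k ∈ Finset.range n, r ^ k) *
          (∏ k ∈ Finset.range n, p k) ^ 2 := by
        rw [Finset.prod_mul_distrib, ← Real.exp_sum, Finset.mul_sum, Finset.prod_pow]
    _ ≤ Real.exp (C / a ^ 2 / (1 - r)) * (∏ k ∈ Finset.range n, p k) ^ 2 := by
        rw [div_eq_mul_inv _ (1 - r)]
        gcongr

/- The factors with `Δ ≤ r ^ k` are bounded by `p k`, at the cost of a factor `a⁻¹` each; since
`r ≤ a ^ 2` this costs `1 / √Δ` in total. -/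
lemma prod_le_div_sqrt_mul_sq_prod (ha : 0 < a) (ha1 : a ≤ 1) (hr0 : 0 < r) (hr1 : r < 1)
    (hra : r ≤ a ^ 2) (hC : 0 ≤ C) (hΔ0 : 0 < Δ) (hΔ1 : Δ ≤ 1) (hp : ∀ k, a ≤ p k)
    (hv0 : ∀ k, 0 ≤ v k) (hvp : ∀ k, v k ≤ p k) (hv : ∀ k, v k ≤ p k ^ 2 + C * r ^ k / Δ) (n : ℕ) :
    ∏ k ∈ Finset.range n, v k ≤
      a⁻¹ * Real.exp (C / a ^ 2 / (1 - r)) / √Δ * (∏ k ∈ Finset.range n, p k) ^ 2 := by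
  obtain ⟨m, hmlt, hmle⟩ := exists_nat_pow_near_of_lt_one hΔ0 hΔ1 hr0 hr1
  have hsqrt : 0 < √Δ := Real.sqrt_pos.2 hΔ0
  have hpow : a⁻¹ ^ m ≤ (√Δ)⁻¹ := by
    rw [inv_pow]
    refine inv_anti₀ hsqrt ((Real.sqrt_le_left (by positivity)).2 (hmle.trans ?_))
    rw [← pow_mul, mul_comm, pow_mul]
    exact pow_le_pow_left₀ hr0.le hra m
  have hexp : 1 ≤ Real.exp (C / a ^ 2 / (1 - r)) :=
    Real.one_le_exp (div_nonneg (by positivity) (sub_nonneg.2 hr1.le))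
  have head : ∀ i ≤ m + 1, ∏ k ∈ Finset.range i, v k ≤
      a⁻¹ / √Δ * (∏ k ∈ Finset.range i, p k) ^ 2 := fun i hi => by
    refine (prod_le_inv_pow_mul_sq_prod ha hp hv0 hvp i).trans ?_
    gcongr
    calc a⁻¹ ^ i ≤ a⁻¹ ^ (m + 1) := pow_le_pow_right₀ (one_le_inv_iff₀.2 ⟨ha, ha1⟩) hi
      _ = a⁻¹ * a⁻¹ ^ m := pow_succ' _ _
      _ ≤ a⁻¹ / √Δ := by rw [div_eq_mul_inv]; gcongr
  rcases le_or_gt n (m + 1) with hn | hn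
  · refine (head n hn).trans ?_
    gcongr
    exact le_mul_of_one_le_right (by positivity) hexp
  obtain ⟨j, rfl⟩ := Nat.exists_eq_add_of_le hn.le
  have tail : ∏ k ∈ Finset.range j, v (m + 1 + k) ≤
      Real.exp (C / a ^ 2 / (1 - r)) * (∏ k ∈ Finset.range j, p (m + 1 + k)) ^ 2 := by
    refine prod_le_exp_mul_sq_prod ha hr0.le hr1 hC (fun k => hp _) (fun k => hv0 _)
      (fun k => (hv _).trans ?_) j
    calc p (m + 1 + k) ^ 2 + C * r ^ (m + 1 + k) / Δ
        = p (m + 1 + k) ^ 2 + C * (r ^ (m + 1) / Δ * r ^ k) := by rw [pow_add]; ring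
      _ ≤ p (m + 1 + k) ^ 2 + C * (1 * r ^ k) := by
          gcongr; exact (div_le_one hΔ0).2 hmlt.le
      _ = p (m + 1 + k) ^ 2 + C * r ^ k := by rw [one_mul]
  rw [Finset.prod_range_add v, Finset.prod_range_add p]
  calc _ ≤ a⁻¹ / √Δ * (∏ k ∈ Finset.range (m + 1), p k) ^ 2 *
        (Real.exp (C / a ^ 2 / (1 - r)) * (∏ k ∈ Finset.range j, p (m + 1 + k)) ^ 2) :=
        mul_le_mul (head _ le_rfl) tail (Finset.prod_nonneg fun k _ => hv0 _) (by positivity)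
    _ = _ := by ring

end ProductBound

/-- The linear size `2 ^ (k + 1)` of scale `k`, whose duration is the square of this size and
during which the path is allowed to descend by four times this size. -/
def scaleSize (k : ℕ) : ℕ := 2 ^ (k + 1)

/-- The probability of the event of scale `k`: the simple random walk does not descend by more
than `4 * scaleSize k` within the duration of scale `k`. -/
noncomputable def scaleProb (k : ℕ) : ℝ := stayProb (scaleSize k ^ 2) (4 * scaleSize k : ℕ)

/-- The probability that the event of scale `k` occurs in both of two webs of correlation `ρ`. -/
noncomputable def pairScaleProb (ρ : ℝ) (k : ℕ) : ℝ :=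
  pairStayProb ρ (scaleSize k ^ 2) (4 * scaleSize k : ℕ) (4 * scaleSize k : ℕ)

lemma pairScaleProb_one (k : ℕ) : pairScaleProb 1 k = scaleProb k := pairStayProb_one _ _

lemma le_stayProb_sq (n : ℕ) : 15 / 16 ≤ stayProb (n ^ 2) (4 * n : ℕ) := by
  have hkolmogorov := one_sub_stayProb_le (4 * n) (n ^ 2) (x := (4 * n : ℕ)) (by omega)
  have hratio : ((n ^ 2 : ℕ) : ℝ) / (((4 * n : ℕ) : ℝ) + 1) ^ 2 ≤ 1 / 16 := by
    rw [div_le_div_iff₀ (by positivity) (by norm_num)]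
    push_cast
    nlinarith [n.cast_nonneg (α := ℝ)]
  norm_num at hkolmogorov hratio ⊢
  linarith

lemma half_le_one_sub_exp_neg {Δ : ℝ} (h0 : 0 ≤ Δ) (h1 : Δ ≤ 1) :
    Δ / 2 ≤ 1 - Real.exp (-Δ) := by
  have hmul : (1 - Real.exp (-Δ)) * (Δ + 1) ≥ Δ := by
    have := mul_le_mul_of_nonneg_left (Real.add_one_le_exp Δ) (Real.exp_pos (-Δ)).le
    rw [← Real.exp_add, neg_add_cancel, Real.exp_zero] at this
    linarith
  nlinarith

lemma pairStayProb_sq_le {Δ : ℝ} (h0 : 0 < Δ) (h1 : Δ ≤ 1) {n : ℕ} (hn : 0 < n) (x : ℤ) :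
    pairStayProb (Real.exp (-Δ)) (n ^ 2) x x ≤ stayProb (n ^ 2) x ^ 2 + 128 / √n / Δ := by
  have hn' : (0 : ℝ) < n := by exact_mod_cast hn
  have hΔ := half_le_one_sub_exp_neg h0.le h1
  have hlog : 1 + Real.log ((n ^ 2 : ℕ) : ℝ) ≤ 4 * √n := by
    have := Real.log_le_sub_one_of_pos (Real.sqrt_pos.2 hn')
    rw [Real.log_sqrt hn'.le] at this
    rw [Nat.cast_pow, Real.log_pow]
    push_cast
    linarith
  refine (pairStayProb_self_le (Real.exp_pos _).le (by linarith) (pow_pos hn 2) x).trans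
    (add_le_add_right ?_ _)
  calc 16 * (1 + Real.log ((n ^ 2 : ℕ) : ℝ)) / (√((n ^ 2 : ℕ) : ℝ) * (1 - Real.exp (-Δ)))
      ≤ 16 * (4 * √n) / (√((n ^ 2 : ℕ) : ℝ) * (Δ / 2)) := by gcongr
    _ = 128 / √n / Δ := by
        have hsqrt : √(n : ℝ) ≠ 0 := (Real.sqrt_pos.2 hn').ne'
        rw [Nat.cast_pow, Real.sqrt_sq hn'.le]
        field_simp
        rw [Real.sq_sqrt hn'.le]
        ring

lemma inv_sqrt_scaleSize_le (k : ℕ) : (√(scaleSize k))⁻¹ ≤ (√2)⁻¹ ^ k := by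
  rw [inv_pow]
  refine inv_anti₀ (by positivity) (Real.le_sqrt_of_sq_le ?_)
  rw [← pow_mul, mul_comm, pow_mul, Real.sq_sqrt zero_le_two, scaleSize, Nat.cast_pow,
    Nat.cast_ofNat]
  exact pow_le_pow_right₀ one_le_two k.le_succ

lemma exists_prod_pairScaleProb_le :
    ∃ C : ℝ, ∀ Δ : ℝ, 0 < Δ → Δ ≤ 1 → ∀ n,
      ∏ k ∈ Finset.range n, pairScaleProb (Real.exp (-Δ)) k ≤
        C / √Δ * (∏ k ∈ Finset.range n, scaleProb k) ^ 2 := by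
  have hr1 : (√2)⁻¹ < 1 := inv_lt_one_of_one_lt₀ Real.one_lt_sqrt_two
  have hra : (√2)⁻¹ ≤ (15 / 16) ^ 2 := by
    refine inv_le_of_inv_le₀ (by norm_num) (Real.le_sqrt_of_sq_le ?_)
    norm_num
  refine ⟨(15 / 16)⁻¹ * Real.exp (128 / (15 / 16) ^ 2 / (1 - (√2)⁻¹)),
    fun Δ h0 h1 n => ?_⟩
  have hρ0 : 0 ≤ Real.exp (-Δ) := (Real.exp_pos _).le
  have hρ : |Real.exp (-Δ)| ≤ 1 := by
    rw [abs_of_nonneg hρ0, Real.exp_le_one_iff]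
    linarith
  refine prod_le_div_sqrt_mul_sq_prod (by norm_num) (by norm_num) (by positivity) hr1 hra
    (by norm_num) h0 h1 (fun k => le_stayProb_sq _) (fun k => pairStayProb_nonneg hρ _ _ _)
    (fun k => pairStayProb_le_stayProb hρ _ _ _) (fun k => ?_) n
  refine (pairStayProb_sq_le h0 h1 (pow_pos two_pos (k + 1)) _).trans (add_le_add_right ?_ _)
  rw [div_eq_mul_inv 128]
  gcongr
  exact inv_sqrt_scaleSize_le k

lemma exists_eventually_scaleProb_le : ∃ q < 1, ∀ᶠ k in Filter.atTop, scaleProb k ≤ q := by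
  obtain ⟨q, hq, h⟩ := exists_stayProb_sq_le 4
  refine ⟨q, hq, Filter.Tendsto.eventually (f := scaleSize) ?_ h⟩
  exact (tendsto_pow_atTop_atTop_of_one_lt one_lt_two).comp (Filter.tendsto_add_atTop_nat 1)

/-! ### Independence and exponential waiting times -/

section Independence

variable {Ω α β ι κ : Type*} {mΩ : MeasurableSpace Ω} {P : Measure Ω}

lemma iIndep_sumElim {m₁ : ι → MeasurableSpace Ω} {m₂ : κ → MeasurableSpace Ω}
    (h₁ : iIndep m₁ P) (h₂ : iIndep m₂ P) (h : Indep (⨆ i, m₁ i) (⨆ k, m₂ k) P) :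
    iIndep (Sum.elim m₁ m₂) P := by
  refine (iIndep_iff _ _).2 fun s f hf => ?_
  have hleft : ∀ i ∈ s.toLeft, MeasurableSet[m₁ i] (f (Sum.inl i)) := fun i hi =>
    hf _ (Finset.mem_toLeft.1 hi)
  have hright : ∀ k ∈ s.toRight, MeasurableSet[m₂ k] (f (Sum.inr k)) := fun k hk =>
    hf _ (Finset.mem_toRight.1 hk)
  have hinter : ⋂ i ∈ s, f i =
      (⋂ i ∈ s.toLeft, f (Sum.inl i)) ∩ ⋂ k ∈ s.toRight, f (Sum.inr k) := by
    ext; simp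
  rw [hinter, (Indep_iff _ _ _).1 h, h₁.meas_biInter hleft, h₂.meas_biInter hright,
    ← Finset.prod_disjSum s.toLeft s.toRight fun i => P (f i), Finset.toLeft_disjSum_toRight]
  · exact Finset.measurableSet_biInter _ fun i hi => le_iSup m₁ i _ (hleft i hi)
  · exact Finset.measurableSet_biInter _ fun k hk => le_iSup m₂ k _ (hright k hk)

lemma iIndep_biSup_of_pairwiseDisjoint {m : ι → MeasurableSpace Ω} (hm : ∀ i, m i ≤ mΩ)
    (h : iIndep m P) {T : κ → Set ι} (hT : Pairwise (Function.onFun Disjoint T)) :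
    iIndep (fun k => ⨆ i ∈ T k, m i) P := by
  classical
  refine (iIndep_iff _ _).2 fun s f hf => ?_
  induction s using Finset.induction_on with
  | empty => simpa using h.meas_biInter (S := ∅) (s := fun _ => Set.univ) (by simp)
  | insert k s hk ih =>
    have hdisj : Disjoint (T k) (⋃ k' ∈ s, T k') :=
      Set.disjoint_iUnion₂_right.2 fun k' hk' => hT (ne_of_mem_of_not_mem hk' hk).symm
    rw [Finset.set_biInter_insert, Finset.prod_insert hk,
      (Indep_iff _ _ _).1 (indep_iSup_of_disjoint hm h hdisj) _ _ (hf k (by simp)),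
      ih fun k' hk' => hf k' (by simp [hk'])]
    refine Finset.measurableSet_biInter _ fun k' hk' => ?_
    have hle : ⨆ i ∈ T k', m i ≤ ⨆ i ∈ ⋃ k' ∈ s, T k', m i :=
      biSup_mono fun i hi => Set.mem_biUnion hk' hi
    exact hle _ (hf k' (by simp [hk']))

/- The second Borel–Cantelli lemma for the complements. -/
lemma ae_frequently_notMem_of_iIndep {m : ℕ → MeasurableSpace Ω} (hm : ∀ n, m n ≤ mΩ)
    (h : iIndep m P) {A : ℕ → Set Ω} (hA : ∀ n, MeasurableSet[m n] (A n)) {q : ENNReal}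
    (hq : q < 1) (hAq : ∀ᶠ n in Filter.atTop, P (A n) ≤ q) :
    ∀ᵐ ω ∂P, ∃ᶠ n in Filter.atTop, ω ∉ A n := by
  have hprob : P Set.univ = 1 := by
    simpa using h.meas_biInter (S := ∅) (s := fun _ => Set.univ) (by simp)
  have : IsProbabilityMeasure P := ⟨hprob⟩
  have hmeas : ∀ n, MeasurableSet (A n) := fun n => hm n _ (hA n)
  have hindep : iIndepSet (fun n => (A n)ᶜ) P :=
    (iIndepSet_iff_meas_biInter fun n => (hmeas n).compl).2 fun s =>
      h.meas_biInter fun n _ => (hA n).compl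
  have hsum : ∑' n, P (A n)ᶜ = ⊤ := by
    by_contra hne
    have hlim := (ENNReal.tendsto_atTop_zero_of_tsum_ne_top hne).eventually_lt_const
      (tsub_pos_of_lt hq)
    obtain ⟨n, hlt, hle⟩ := (hlim.and hAq).exists
    rw [prob_compl_eq_one_sub (hmeas n)] at hlt
    exact hlt.not_ge (tsub_le_tsub_left hle 1)
  have hlimsup := measure_limsup_eq_one (fun n => (hmeas n).compl) hindep hsum
  rw [← prob_compl_eq_zero_iff
    (MeasurableSet.measurableSet_limsup fun n => (hmeas n).compl)] at hlimsup
  filter_upwards [measure_eq_zero_iff_ae_notMem.1 hlimsup] with ω hω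
  simpa [Filter.mem_limsup_iff_frequently_mem, Filter.frequently_atTop] using hω

lemma measureReal_mem_eq_sum_of_indep [IsFiniteMeasure P] [Fintype α] [MeasurableSpace α]
    [MeasurableSingletonClass α] {m₁ m₂ : MeasurableSpace Ω} (hm₁ : m₁ ≤ mΩ) (hm₂ : m₂ ≤ mΩ)
    (h : Indep m₁ m₂ P) {T : Ω → α} (hT : Measurable[m₁] T) {E : α → Set Ω}
    (hE : ∀ a, MeasurableSet[m₂] (E a)) :
    P.real {ω | ω ∈ E (T ω)} = ∑ a, P.real (T ⁻¹' {a}) * P.real (E a) := by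
  have hfiber : ∀ a, MeasurableSet[m₁] (T ⁻¹' {a}) := fun a => hT (measurableSet_singleton a)
  have hunion : {ω | ω ∈ E (T ω)} = ⋃ a ∈ Finset.univ, (T ⁻¹' {a} ∩ E a) := by
    ext; simp
  rw [hunion, measureReal_biUnion_finset]
  · refine Finset.sum_congr rfl fun a _ => ?_
    rw [measureReal_def, (Indep_iff _ _ _).1 h _ _ (hfiber a) (hE a), ENNReal.toReal_mul]
    rfl
  · intro a _ b _ hab
    exact ((Set.disjoint_singleton.2 hab).preimage T).mono Set.inter_subset_left
      Set.inter_subset_left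
  · exact fun a _ => (hm₁ _ (hfiber a)).inter (hm₂ _ (hE a))

variable [IsFiniteMeasure P] [mα : MeasurableSpace α] {T : Ω → α}

/- Freezing: `T` may be held fixed while integrating over the independent `Y`. -/
lemma measure_prodMk_mem_eq_lintegral [MeasurableSpace β] {Y : Ω → β}
    (hT : Measurable T) (hY : Measurable Y) (h : IndepFun T Y P) {D : Set (α × β)}
    (hD : MeasurableSet D) :
    P {ω | (T ω, Y ω) ∈ D} = ∫⁻ ω, P {ω' | (T ω, Y ω') ∈ D} ∂P := by
  calc P {ω | (T ω, Y ω) ∈ D}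
      = P.map (fun ω => (T ω, Y ω)) D := (Measure.map_apply (hT.prodMk hY) hD).symm
    _ = ((P.map T).prod (P.map Y)) D := by
        rw [(indepFun_iff_map_prod_eq_prod_map_map hT.aemeasurable hY.aemeasurable).1 h]
    _ = ∫⁻ ω, P.map Y (Prod.mk (T ω) ⁻¹' D) ∂P := by
        rw [Measure.prod_apply hD, lintegral_map (measurable_measure_prodMk_left hD) hT]
    _ = ∫⁻ ω, P {ω' | (T ω, Y ω') ∈ D} ∂P :=
        lintegral_congr fun ω => Measure.map_apply hY (measurable_prodMk_left hD)

lemma measureReal_prodMk_mem_eq_integral [MeasurableSpace β] {Y : Ω → β}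
    (hT : Measurable T) (hY : Measurable Y) (h : IndepFun T Y P) {D : Set (α × β)}
    (hD : MeasurableSet D) :
    P.real {ω | (T ω, Y ω) ∈ D} = ∫ ω, P.real {ω' | (T ω, Y ω') ∈ D} ∂P := by
  have hmeas : Measurable fun ω => P {ω' | (T ω, Y ω') ∈ D} :=
    (measurable_measure_prodMk_left (ν := P)
      (hD.preimage (measurable_fst.prodMk (hY.comp measurable_snd)))).comp hT
  rw [measureReal_def, measure_prodMk_mem_eq_lintegral hT hY h hD,
    ← integral_toReal hmeas.aemeasurable (.of_forall fun ω => measure_lt_top _ _)]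
  rfl

lemma measure_graph_eq_zero {m₁ m₂ : MeasurableSpace Ω} (hm₁ : m₁ ≤ mΩ) (hm₂ : m₂ ≤ mΩ)
    (h : Indep m₁ m₂ P) (hT : Measurable[m₁] T) {D : Set (α × Ω)}
    (hD : MeasurableSet[mα.prod m₂] D)
    (h0 : ∀ a, P {ω | (a, ω) ∈ D} = 0) : P {ω | (T ω, ω) ∈ D} = 0 := by
  have hind : @IndepFun Ω α Ω _ _ m₂ T id P := by
    refine (@IndepFun_iff_Indep Ω α Ω mΩ _ m₂ T id P).2 ?_
    rw [MeasurableSpace.comap_id]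
    exact indep_of_indep_of_le_left h hT.comap_le
  have := @measure_prodMk_mem_eq_lintegral Ω α Ω mΩ P _ _ T m₂ id (hT.mono hm₁ le_rfl)
    (measurable_id'' hm₂) hind D hD
  simpa [h0] using this

end Independence

lemma expMeasure_Ioi {r a : ℝ} (hr : 0 < r) (ha : 0 ≤ a) :
    expMeasure r (Set.Ioi a) = ENNReal.ofReal (Real.exp (-(r * a))) := by
  have : IsProbabilityMeasure (expMeasure r) := isProbabilityMeasure_expMeasure hr
  rw [← Set.compl_Iic, prob_compl_eq_one_sub measurableSet_Iic, ← ofReal_cdf,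
    cdf_expMeasure_eq hr, if_pos ha, ← ENNReal.ofReal_one,
    ← ENNReal.ofReal_sub _ (by simpa using mul_nonneg hr.le ha), sub_sub_cancel]

lemma expMeasure_singleton (r a : ℝ) : expMeasure r {a} = 0 :=
  withDensity_absolutelyContinuous _ _ (measure_singleton a)

lemma measure_le_lt_add_eq_exp_mul {Ω : Type*} [MeasurableSpace Ω] {P : Measure Ω}
    [IsFiniteMeasure P] {T V : Ω → ℝ} {r τ τ' : ℝ} (hr : 0 < r) (hT : Measurable T)
    (hV : Measurable V) (h : IndepFun T V P) (hlaw : P.map V = expMeasure r) (hτ : τ ≤ τ') :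
    P {ω | T ω ≤ τ ∧ τ' < T ω + V ω} =
      ENNReal.ofReal (Real.exp (-(r * (τ' - τ)))) * P {ω | T ω ≤ τ ∧ τ < T ω + V ω} := by
  have hD : ∀ τ', MeasurableSet {p : ℝ × ℝ | p.1 ≤ τ ∧ τ' < p.1 + p.2} := fun τ' =>
    (measurableSet_le measurable_fst measurable_const).inter
      (measurableSet_lt measurable_const (measurable_fst.add measurable_snd))
  have hsection : ∀ s t, τ ≤ s →
      P {ω | t ≤ τ ∧ s < t + V ω} =
      (Set.Iic τ).indicator (fun t => ENNReal.ofReal (Real.exp (-(r * (s - t))))) t := by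
    intro s t hs
    by_cases ht : t ≤ τ
    · rw [Set.indicator_of_mem (show t ∈ Set.Iic τ from ht), ← expMeasure_Ioi hr (by linarith),
        ← hlaw, Measure.map_apply hV measurableSet_Ioi]
      simp [ht, Set.preimage, sub_lt_iff_lt_add']
    · simp [ht]
  have hfreeze : ∀ s, τ ≤ s → P {ω | T ω ≤ τ ∧ s < T ω + V ω} =
      ∫⁻ ω, (Set.Iic τ).indicator (fun t => ENNReal.ofReal (Real.exp (-(r * (s - t))))) (T ω) ∂P :=
    fun s hs => (measure_prodMk_mem_eq_lintegral hT hV h (hD s)).trans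
      (lintegral_congr fun ω => hsection s (T ω) hs)
  rw [hfreeze τ' hτ, hfreeze τ le_rfl, ← lintegral_const_mul' _ _ ENNReal.ofReal_ne_top]
  refine lintegral_congr fun ω => ?_
  rw [Set.indicator_apply, Set.indicator_apply]
  split_ifs
  · rw [← ENNReal.ofReal_mul (Real.exp_pos _).le, ← Real.exp_add]
    ring_nf
  · rw [mul_zero]

/-! ### The sources of randomness -/

lemma iSup_comap_eq_comap_pi {Ω ι : Type*} {X : ι → Type*} [∀ i, MeasurableSpace (X i)]
    (f : ∀ i, Ω → X i) :
    ⨆ i, MeasurableSpace.comap (f i) inferInstance =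
      MeasurableSpace.comap (fun ω i => f i ω) MeasurableSpace.pi := by
  simp [MeasurableSpace.pi, MeasurableSpace.comap_iSup, MeasurableSpace.comap_comp,
    Function.comp_def]

lemma mem_iff_lt_ncard_of_isLowerSet {s : Set ℕ} (hs : IsLowerSet s) (hfin : s.Finite) {k : ℕ} :
    k ∈ s ↔ k < s.ncard := by
  rcases hs.eq_univ_or_Iio with rfl | ⟨n, rfl⟩
  · exact absurd hfin Set.infinite_univ
  · rw [Set.ncard_Iio_nat, Set.mem_Iio]

lemma measurable_ncard_setOf {α : Type*} [MeasurableSpace α] {p : ℕ → α → Prop}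
    (h : ∀ n, MeasurableSet {a | p n a}) : Measurable fun a => {n | p n a}.ncard :=
  measurable_ncard.comp (measurable_set_iff.2 fun n => measurableSet_setOfPred.1 (h n))

lemma measure_eq_fun_eq_tsum {Ω β : Type*} [MeasurableSpace Ω] {P : Measure Ω} [Countable β]
    [MeasurableSpace β] [MeasurableSingletonClass β] {T T' : Ω → β} (hT : Measurable T)
    (hT' : Measurable T') : P {ω | T ω = T' ω} = ∑' b, P {ω | T ω = b ∧ T' ω = b} := by
  have hunion : {ω | T ω = T' ω} = ⋃ b, {ω | T ω = b ∧ T' ω = b} := by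
    ext ω; simp [eq_comm]
  rw [hunion, measure_iUnion]
  · exact fun b b' hb => Set.disjoint_left.2 fun ω h h' => hb (h.1.symm.trans h'.1)
  · exact fun b => (hT (measurableSet_singleton b)).inter (hT' (measurableSet_singleton b))

namespace DynamicalDiscreteWeb

section SiteSigma

variable {Ω : Type*} [mΩ : MeasurableSpace Ω] {P : Measure Ω} (W : DynamicalDiscreteWeb P)

/-- The σ-algebra generated by a single waiting time (left) or a single arrow (right). -/
abbrev atomSigma : (EvenSite × ℕ) ⊕ (EvenSite × ℕ) → MeasurableSpace Ω :=
  Sum.elim (fun i => .comap (W.wait i.1 i.2) inferInstance)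
    fun i => .comap (W.arrow i.1 i.2) inferInstance

/-- The σ-algebra generated by all waiting times and arrows at the sites of `S`. -/
abbrev siteSigma (S : Set EvenSite) : MeasurableSpace Ω :=
  ⨆ j ∈ Sum.elim Prod.fst Prod.fst ⁻¹' S, W.atomSigma j

lemma atomSigma_le (j : (EvenSite × ℕ) ⊕ (EvenSite × ℕ)) : W.atomSigma j ≤ mΩ := by
  rcases j with i | i
  · exact (W.measurable_wait i.1 i.2).comap_le
  · exact (W.measurable_arrow i.1 i.2).comap_le

lemma siteSigma_le (S : Set EvenSite) : W.siteSigma S ≤ mΩ :=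
  iSup₂_le fun j _ => W.atomSigma_le j

lemma measurable_siteSigma_wait {S : Set EvenSite} {z : EvenSite} (h : z ∈ S) (n : ℕ) :
    Measurable[W.siteSigma S] (W.wait z n) :=
  (comap_measurable _).mono
    (le_biSup W.atomSigma (show Sum.inl (z, n) ∈ Sum.elim Prod.fst Prod.fst ⁻¹' S from h)) le_rfl

lemma measurable_siteSigma_arrow {S : Set EvenSite} {z : EvenSite} (h : z ∈ S) (n : ℕ) :
    Measurable[W.siteSigma S] (W.arrow z n) :=
  (comap_measurable _).mono
    (le_biSup W.atomSigma (show Sum.inr (z, n) ∈ Sum.elim Prod.fst Prod.fst ⁻¹' S from h)) le_rfl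

lemma iIndep_atomSigma : iIndep W.atomSigma P := by
  refine iIndep_sumElim W.indep_wait W.indep_arrow ?_
  rw [iSup_comap_eq_comap_pi, iSup_comap_eq_comap_pi]
  exact W.indep_wait_arrow

lemma iIndep_siteSigma {κ : Type*} {S : κ → Set EvenSite}
    (h : Pairwise (Function.onFun Disjoint S)) : iIndep (fun k => W.siteSigma (S k)) P :=
  iIndep_biSup_of_pairwiseDisjoint W.atomSigma_le W.iIndep_atomSigma
    fun _ _ hkl => (h hkl).preimage _

lemma indep_siteSigma {S T : Set EvenSite} (h : Disjoint S T) :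
    Indep (W.siteSigma S) (W.siteSigma T) P :=
  indep_iSup_of_disjoint W.atomSigma_le W.iIndep_atomSigma (h.preimage _)

end SiteSigma

section Measurability

variable {Ω : Type*} {m : MeasurableSpace Ω} [MeasurableSpace Ω] {P : Measure Ω}
  (W : DynamicalDiscreteWeb P) {z : EvenSite}

lemma measurable_ringCount (h : ∀ n, Measurable[m] (W.wait z n)) :
    Measurable[Real.measurableSpace.prod m] (Function.uncurry (W.ringCount z)) := by
  let _ : MeasurableSpace (ℝ × Ω) := Real.measurableSpace.prod m
  refine measurable_ncard_setOf fun n => measurableSet_le ?_ measurable_fst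
  exact Finset.measurable_fun_sum _ fun i _ => (h i).comp measurable_snd

lemma measurable_arrowAt (h : ∀ n, Measurable[m] (W.wait z n))
    (h' : ∀ n, Measurable[m] (W.arrow z n)) :
    Measurable[Real.measurableSpace.prod m]
      (Function.uncurry fun τ ω => W.arrowAt τ ω z) := by
  let _ : MeasurableSpace (ℝ × Ω) := Real.measurableSpace.prod m
  have harrow : Measurable fun q : ℕ × (ℝ × Ω) => W.arrow z q.1 q.2.2 :=
    measurable_from_prod_countable_right fun n => (h' n).comp measurable_snd
  exact harrow.comp ((W.measurable_ringCount h).prodMk measurable_id)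

lemma measurable_ringCount_apply (h : ∀ n, Measurable[m] (W.wait z n)) (τ : ℝ) :
    Measurable[m] (W.ringCount z τ) :=
  @Measurable.of_uncurry_left _ _ _ _ m _ _ (W.measurable_ringCount h) τ

lemma measurable_arrowAt_apply (h : ∀ n, Measurable[m] (W.wait z n))
    (h' : ∀ n, Measurable[m] (W.arrow z n)) (τ : ℝ) : Measurable[m] fun ω => W.arrowAt τ ω z :=
  @Measurable.of_uncurry_left _ _ _ _ m _ _ (W.measurable_arrowAt h h') τ

end Measurability

/-! ### The clocks -/

section Clock

variable {Ω : Type*} [MeasurableSpace Ω] {P : Measure Ω} (W : DynamicalDiscreteWeb P)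
  {z : EvenSite} {ω : Ω} {τ τ' : ℝ}

/-- The dynamical time of the `n`-th ring of the clock at `z`, and `0` for `n = 0`; this is
`ringTime` with the index shifted by one. -/
def clock (z : EvenSite) (n : ℕ) (ω : Ω) : ℝ := ∑ i ∈ Finset.range n, W.wait z i ω

lemma clock_succ (z : EvenSite) (n : ℕ) (ω : Ω) :
    W.clock z (n + 1) ω = W.clock z n ω + W.wait z n ω := Finset.sum_range_succ _ _

/-- The regularity of a clock that holds almost surely: its rings are distinct and do not
accumulate. -/
structure GoodClock (z : EvenSite) (ω : Ω) : Prop where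
  wait_pos : ∀ n, 0 < W.wait z n ω
  unbounded : ∀ τ : ℝ, ∃ n, τ < W.clock z n ω

variable {W}

lemma GoodClock.strictMono (h : W.GoodClock z ω) : StrictMono fun n => W.clock z n ω :=
  strictMono_nat_of_lt_succ fun n => by
    rw [clock_succ]
    exact lt_add_of_pos_right _ (h.wait_pos n)

lemma GoodClock.finite_setOf_ringTime_le (h : W.GoodClock z ω) (τ : ℝ) :
    {k | W.ringTime z k ω ≤ τ}.Finite := by
  obtain ⟨n, hn⟩ := h.unbounded τ
  refine (Set.finite_Iio n).subset fun k hk => ?_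
  have hlt : k + 1 < n := h.strictMono.lt_iff_lt.1 (lt_of_le_of_lt hk hn)
  exact (Nat.lt_succ_self k).trans hlt

lemma GoodClock.lt_ringCount_iff (h : W.GoodClock z ω) {k : ℕ} :
    k < W.ringCount z τ ω ↔ W.ringTime z k ω ≤ τ := by
  have hmono : Monotone fun k => W.ringTime z k ω := fun i j hij =>
    h.strictMono.monotone (Nat.succ_le_succ hij)
  exact (mem_iff_lt_ncard_of_isLowerSet (fun _ _ hba ha => (hmono hba).trans ha)
    (h.finite_setOf_ringTime_le τ)).symm

lemma GoodClock.le_ringCount_iff (h : W.GoodClock z ω) (hτ : 0 ≤ τ) {n : ℕ} :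
    n ≤ W.ringCount z τ ω ↔ W.clock z n ω ≤ τ := by
  cases n with
  | zero => simpa [clock] using hτ
  | succ k => exact h.lt_ringCount_iff

lemma GoodClock.ringCount_eq_iff (h : W.GoodClock z ω) (hτ : 0 ≤ τ) {n : ℕ} :
    W.ringCount z τ ω = n ↔ W.clock z n ω ≤ τ ∧ τ < W.clock z (n + 1) ω := by
  rw [← h.le_ringCount_iff hτ, ← not_le, ← h.le_ringCount_iff hτ]
  omega

variable (W)

lemma measurable_clock (z : EvenSite) (n : ℕ) : Measurable (W.clock z n) :=
  Finset.measurable_fun_sum _ fun i _ => W.measurable_wait z i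

lemma iIndepFun_wait (z : EvenSite) : iIndepFun (W.wait z) P :=
  W.indep_wait.precomp (g := fun n => (z, n)) (Prod.mk_right_injective z)

lemma indepFun_clock_wait (z : EvenSite) (n : ℕ) : IndepFun (W.clock z n) (W.wait z n) P := by
  have h := (W.iIndepFun_wait z).indepFun_finsetSum_of_notMem (W.measurable_wait z)
    (Finset.notMem_range_self (n := n))
  rwa [Finset.sum_fn] at h

lemma measure_wait_preimage (z : EvenSite) (n : ℕ) {s : Set ℝ} (hs : MeasurableSet s) :
    P (W.wait z n ⁻¹' s) = expMeasure 1 s := by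
  rw [← W.wait_law z n, Measure.map_apply (W.measurable_wait z n) hs]

lemma ae_wait_pos (z : EvenSite) (n : ℕ) : ∀ᵐ ω ∂P, 0 < W.wait z n ω := by
  have : IsProbabilityMeasure (expMeasure 1) := isProbabilityMeasure_expMeasure one_pos
  have hnull : P (W.wait z n ⁻¹' Set.Iic 0) = 0 := by
    rw [W.measure_wait_preimage z n measurableSet_Iic, ← ofReal_cdf, cdf_expMeasure_eq one_pos]
    simp
  filter_upwards [measure_eq_zero_iff_ae_notMem.1 hnull] with ω hω using not_le.1 hω

lemma ae_exists_lt_wait (z : EvenSite) (a : ℝ) : ∀ᵐ ω ∂P, ∃ n, a < W.wait z n ω := by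
  have : IsProbabilityMeasure (expMeasure 1) := isProbabilityMeasure_expMeasure one_pos
  have hlt : expMeasure 1 (Set.Iic a) < 1 := by
    rw [← ofReal_cdf, cdf_expMeasure_eq one_pos, ENNReal.ofReal_lt_one]
    split_ifs
    · linarith [Real.exp_pos (-(1 * a))]
    · exact one_pos
  have hfreq := ae_frequently_notMem_of_iIndep (fun n => (W.measurable_wait z n).comap_le)
    (W.iIndepFun_wait z) (A := fun n => W.wait z n ⁻¹' Set.Iic a)
    (fun n => ⟨_, measurableSet_Iic, rfl⟩) hlt
    (.of_forall fun n => (W.measure_wait_preimage z n measurableSet_Iic).le)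
  filter_upwards [hfreq] with ω hω
  obtain ⟨n, hn⟩ := hω.exists
  exact ⟨n, not_le.1 hn⟩

lemma ae_goodClock : ∀ᵐ ω ∂P, ∀ z, W.GoodClock z ω := by
  filter_upwards [ae_all_iff.2 fun z => ae_all_iff.2 (W.ae_wait_pos z),
    ae_all_iff.2 fun z => ae_all_iff.2 fun N : ℕ => W.ae_exists_lt_wait z N] with ω hpos hlong z
  refine ⟨hpos z, fun τ => ?_⟩
  obtain ⟨N, hN⟩ := exists_nat_gt τ
  obtain ⟨n, hn⟩ := hlong z N
  have hclock : 0 ≤ W.clock z n ω := Finset.sum_nonneg fun i _ => (hpos z i).le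
  exact ⟨n + 1, by rw [clock_succ]; linarith⟩

lemma measure_ringCount_eq_and_eq (z : EvenSite) (hτ : 0 ≤ τ) (h : τ ≤ τ') (n : ℕ) :
    P {ω | W.ringCount z τ ω = n ∧ W.ringCount z τ' ω = n} =
      P {ω | W.clock z n ω ≤ τ ∧ τ' < W.clock z n ω + W.wait z n ω} := by
  refine measure_congr (Filter.eventuallyEq_set.2 ?_)
  filter_upwards [W.ae_goodClock] with ω hω
  simp only [(hω z).ringCount_eq_iff hτ, (hω z).ringCount_eq_iff (hτ.trans h),
    ← clock_succ]
  constructor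
  · exact fun H => ⟨H.1.1, H.2.2⟩
  · exact fun H => ⟨⟨H.1, h.trans_lt H.2⟩, H.1.trans h, H.2⟩

lemma measure_ringCount_eq [IsProbabilityMeasure P] (z : EvenSite) (hτ : 0 ≤ τ) (h : τ ≤ τ') :
    P {ω | W.ringCount z τ ω = W.ringCount z τ' ω} = ENNReal.ofReal (Real.exp (-(τ' - τ))) := by
  have hmemoryless : ∀ n, P {ω | W.ringCount z τ ω = n ∧ W.ringCount z τ' ω = n} =
      ENNReal.ofReal (Real.exp (-(τ' - τ))) *
        P {ω | W.ringCount z τ ω = n ∧ W.ringCount z τ ω = n} := by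
    intro n
    rw [W.measure_ringCount_eq_and_eq z hτ h, W.measure_ringCount_eq_and_eq z hτ le_rfl,
      measure_le_lt_add_eq_exp_mul one_pos (W.measurable_clock z n) (W.measurable_wait z n)
        (W.indepFun_clock_wait z n) (W.wait_law z n) h, one_mul]
  have hmeas : ∀ τ, Measurable (W.ringCount z τ) :=
    W.measurable_ringCount_apply (W.measurable_wait z)
  rw [measure_eq_fun_eq_tsum (hmeas τ) (hmeas τ'), tsum_congr hmemoryless, ENNReal.tsum_mul_left,
    ← measure_eq_fun_eq_tsum (hmeas τ) (hmeas τ)]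
  simp

end Clock

end DynamicalDiscreteWeb

/-! ### Correlated arrows and paths above a barrier -/

/-- The endpoint of the arrow with direction `b` at `z`. -/
def EvenSite.step (z : EvenSite) (b : Bool) : EvenSite :=
  followArrow (fun _ => b) z

lemma webPath_succ (ξ : EvenSite → Bool) (z : EvenSite) (n : ℕ) :
    webPath ξ z (n + 1) = webPath ξ (z.step (ξ z)) n := rfl

/-- The path from `z` is at or to the right of `b` during its first `s` steps. -/
def Stays (ξ : EvenSite → Bool) (b : ℤ) (z : EvenSite) (s : ℕ) : Prop :=
  ∀ n ≤ s, b ≤ webPath ξ z n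

lemma stays_zero {ξ : EvenSite → Bool} {b : ℤ} {z : EvenSite} : Stays ξ b z 0 ↔ b ≤ z.1.1 := by
  simp [Stays, webPath]

lemma stays_succ {ξ : EvenSite → Bool} {b : ℤ} {z : EvenSite} {s : ℕ} :
    Stays ξ b z (s + 1) ↔ b ≤ z.1.1 ∧ Stays ξ b (z.step (ξ z)) s := by
  simp only [Stays, ← webPath_succ]
  constructor
  · exact fun h => ⟨h 0 (Nat.zero_le _), fun n hn => h (n + 1) (Nat.succ_le_succ hn)⟩
  · rintro ⟨h0, h⟩ (_ | n) hn
    · exact h0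
    · exact h n (Nat.le_of_succ_le_succ hn)

/-- The sites with time coordinate in `[i, j)`. -/
def levelSet (i j : ℤ) : Set EvenSite := (fun z => z.1.2) ⁻¹' Set.Ico i j

lemma disjoint_levelSet {i j k l : ℤ} (h : j ≤ k) : Disjoint (levelSet i j) (levelSet k l) :=
  (Set.Ico_disjoint_Ico.2 ((min_le_left _ _).trans (h.trans (le_max_right _ _)))).preimage _

namespace DynamicalDiscreteWeb

section Arrows

variable {Ω : Type*} [MeasurableSpace Ω] {P : Measure Ω} (W : DynamicalDiscreteWeb P)

lemma measureReal_arrow_pair (i i' : EvenSite × ℕ) (b b' : Bool) :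
    P.real {ω | W.arrow i.1 i.2 ω = b ∧ W.arrow i'.1 i'.2 ω = b'} =
      (1 + diagCorr 1 i i' * (increment b * increment b')) / 4 := by
  rw [measureReal_def]
  by_cases hi : i = i'
  · subst hi
    by_cases hb : b = b'
    · subst hb
      simp only [and_self, W.arrow_law, diagCorr]
      cases b <;> norm_num [increment]
    · have hempty : {ω | W.arrow i.1 i.2 ω = b ∧ W.arrow i.1 i.2 ω = b'} = ∅ :=
        Set.eq_empty_of_forall_notMem fun ω h => hb (h.1.symm.trans h.2)
      rw [hempty, diagCorr]
      cases b <;> cases b' <;> simp_all [increment]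
  · have hmul := (W.indep_arrow.indepFun hi).measure_inter_preimage_eq_mul {b} {b'}
      (measurableSet_singleton _) (measurableSet_singleton _)
    have hhalf := congrArg₂ (· * ·) (W.arrow_law i.1 i.2 b) (W.arrow_law i'.1 i'.2 b')
    rw [diagCorr, if_neg hi]
    refine (congrArg ENNReal.toReal (hmul.trans hhalf)).trans ?_
    norm_num

/-- The clock of every site has not rung between `τ` and `τ'` with probability `ρ`, which makes
`ρ` the correlation of the arrows of a site at the dynamical times `τ` and `τ'`. -/
def HasCorrelation (τ τ' ρ : ℝ) : Prop :=
  ∀ z, P.real {ω | W.ringCount z τ ω = W.ringCount z τ' ω} = ρ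

lemma hasCorrelation_self [IsProbabilityMeasure P] (τ : ℝ) : W.HasCorrelation τ τ 1 :=
  fun z => by simp

lemma hasCorrelation_exp [IsProbabilityMeasure P] {τ τ' : ℝ} (hτ : 0 ≤ τ) (hτ' : 0 ≤ τ') :
    W.HasCorrelation τ τ' (Real.exp (-|τ - τ'|)) := by
  intro z
  wlog h : τ ≤ τ' generalizing τ τ'
  · have hswap := this hτ' hτ (le_of_not_ge h)
    simpa only [eq_comm, abs_sub_comm] using hswap
  · rw [measureReal_def, W.measure_ringCount_eq z hτ h, ENNReal.toReal_ofReal (Real.exp_pos _).le,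
      abs_sub_comm, abs_of_nonneg (sub_nonneg.2 h)]

lemma indepFun_ringCount_arrow (z z' : EvenSite) (τ τ' : ℝ) :
    IndepFun (fun ω => (W.ringCount z τ ω, W.ringCount z' τ' ω))
      (fun ω (i : EvenSite × ℕ) => W.arrow i.1 i.2 ω) P := by
  have hwait : ∀ z n, Measurable[.comap (fun ω (i : EvenSite × ℕ) => W.wait i.1 i.2 ω)
      inferInstance] (W.wait z n) := fun z n =>
    (measurable_pi_apply (X := fun _ : EvenSite × ℕ => ℝ) (z, n)).comp (comap_measurable _)
  exact indep_of_indep_of_le_left W.indep_wait_arrow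
    ((W.measurable_ringCount_apply (hwait z) τ).prodMk
      (W.measurable_ringCount_apply (hwait z') τ')).comap_le

lemma measurableSet_ringCount_eq (z : EvenSite) (τ τ' : ℝ) :
    MeasurableSet {ω | W.ringCount z τ ω = W.ringCount z τ' ω} :=
  measurableSet_eq_fun (W.measurable_ringCount_apply (W.measurable_wait z) τ)
    (W.measurable_ringCount_apply (W.measurable_wait z) τ')

lemma measureReal_arrowAt_pair [IsProbabilityMeasure P] {τ τ' ρ : ℝ} (h : W.HasCorrelation τ τ' ρ)
    (z z' : EvenSite) (b b' : Bool) :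
    P.real {ω | W.arrowAt τ ω z = b ∧ W.arrowAt τ' ω z' = b'} =
      (1 + diagCorr ρ z z' * (increment b * increment b')) / 4 := by
  let rings : Ω → ℕ × ℕ := fun ω => (W.ringCount z τ ω, W.ringCount z' τ' ω)
  have hrings : Measurable rings :=
    (W.measurable_ringCount_apply (W.measurable_wait z) τ).prodMk
      (W.measurable_ringCount_apply (W.measurable_wait z') τ')
  have hD : MeasurableSet {p : (ℕ × ℕ) × (EvenSite × ℕ → Bool) |
      p.2 (z, p.1.1) = b ∧ p.2 (z', p.1.2) = b'} :=
    (measurable_from_prod_countable_right (f := fun p : (ℕ × ℕ) × (EvenSite × ℕ → Bool) =>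
        p.2 (z, p.1.1)) (fun n => measurable_pi_apply (z, n.1)) (measurableSet_singleton b)).inter
      (measurable_from_prod_countable_right (f := fun p : (ℕ × ℕ) × (EvenSite × ℕ → Bool) =>
        p.2 (z', p.1.2)) (fun n => measurable_pi_apply (z', n.2)) (measurableSet_singleton b'))
  calc P.real {ω | W.arrowAt τ ω z = b ∧ W.arrowAt τ' ω z' = b'}
      = ∫ ω, P.real {ω' | W.arrow z (rings ω).1 ω' = b ∧ W.arrow z' (rings ω).2 ω' = b'} ∂P :=
        measureReal_prodMk_mem_eq_integral hrings
          (measurable_pi_lambda _ fun i => W.measurable_arrow i.1 i.2)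
          (W.indepFun_ringCount_arrow z z' τ τ') hD
    _ = ∫ ω, (1 + diagCorr 1 (z, (rings ω).1) (z', (rings ω).2) *
          (increment b * increment b')) / 4 ∂P :=
        integral_congr_ae (.of_forall fun ω =>
          W.measureReal_arrow_pair (z, (rings ω).1) (z', (rings ω).2) b b')
    _ = (1 + diagCorr ρ z z' * (increment b * increment b')) / 4 := by
        by_cases hz : z = z'
        · subst hz
          have hmeas := W.measurableSet_ringCount_eq z τ τ'
          have hindicator : ∀ ω, diagCorr 1 (z, (rings ω).1) (z, (rings ω).2) =
              {ω | W.ringCount z τ ω = W.ringCount z τ' ω}.indicator 1 ω := fun ω => by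
            simp [diagCorr, rings, Set.indicator_apply]
          have hint : Integrable ({ω | W.ringCount z τ ω = W.ringCount z τ' ω}.indicator 1) P :=
            (integrable_const (1 : ℝ)).indicator hmeas
          simp only [hindicator]
          rw [integral_div, integral_add (integrable_const _) (hint.mul_const _),
            integral_mul_const, integral_indicator_one hmeas, h z, diagCorr, if_pos rfl]
          simp
        · simp [diagCorr, hz]

end Arrows

section Stays

variable {Ω : Type*} [MeasurableSpace Ω] {P : Measure Ω} (W : DynamicalDiscreteWeb P)
  {S : Set EvenSite} {z z' : EvenSite} {s : ℕ}

lemma measurable_siteSigma_arrowAt (hz : z ∈ S) :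
    Measurable[Real.measurableSpace.prod (W.siteSigma S)]
      (Function.uncurry fun τ ω => W.arrowAt τ ω z) :=
  W.measurable_arrowAt (W.measurable_siteSigma_wait hz) (W.measurable_siteSigma_arrow hz)

lemma measurable_siteSigma_arrowAt_apply (hz : z ∈ S) (τ : ℝ) :
    Measurable[W.siteSigma S] fun ω => W.arrowAt τ ω z :=
  W.measurable_arrowAt_apply (W.measurable_siteSigma_wait hz) (W.measurable_siteSigma_arrow hz) τ

lemma measurableSet_stays (b : ℤ) (hS : levelSet z.1.2 (z.1.2 + s) ⊆ S) :
    MeasurableSet[Real.measurableSpace.prod (W.siteSigma S)]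
      {p : ℝ × Ω | Stays (W.arrowAt p.1 p.2) b z s} := by
  induction s generalizing z with
  | zero => simp only [stays_zero]; exact MeasurableSet.const _
  | succ s ih =>
    have hz : z ∈ S := hS ⟨le_rfl, by push_cast; omega⟩
    have hsplit : {p : ℝ × Ω | Stays (W.arrowAt p.1 p.2) b z (s + 1)} =
        {_p : ℝ × Ω | b ≤ z.1.1} ∩ ⋃ c : Bool, ((fun p : ℝ × Ω => W.arrowAt p.1 p.2 z) ⁻¹' {c} ∩
          {p : ℝ × Ω | Stays (W.arrowAt p.1 p.2) b (z.step c) s}) := by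
      ext p
      simp [stays_succ]
    rw [hsplit]
    refine (MeasurableSet.const _).inter (MeasurableSet.iUnion fun c => ?_)
    refine (W.measurable_siteSigma_arrowAt hz (measurableSet_singleton c)).inter (ih ?_)
    refine subset_trans (Set.preimage_mono (Set.Ico_subset_Ico ?_ ?_)) hS
    · exact (lt_add_one _).le
    · simp only [EvenSite.step, followArrow]
      push_cast
      omega

lemma measurableSet_stays_apply (τ : ℝ) (b : ℤ) (hS : levelSet z.1.2 (z.1.2 + s) ⊆ S) :
    MeasurableSet[W.siteSigma S] {ω | Stays (W.arrowAt τ ω) b z s} :=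
  @measurable_prodMk_left _ _ _ (W.siteSigma S) τ _ (W.measurableSet_stays b hS)

variable [IsProbabilityMeasure P] {τ τ' ρ : ℝ} {b : ℤ}

lemma measureReal_stays_pair_succ (h : W.HasCorrelation τ τ' ρ) (hz : z.1.2 = z'.1.2)
    (hbz : b ≤ z.1.1) (hbz' : b ≤ z'.1.1) :
    P.real {ω | Stays (W.arrowAt τ ω) b z (s + 1) ∧ Stays (W.arrowAt τ' ω) b z' (s + 1)} =
      ∑ c : Bool × Bool, (1 + diagCorr ρ z z' * (increment c.1 * increment c.2)) / 4 *
        P.real {ω | Stays (W.arrowAt τ ω) b (z.step c.1) s ∧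
          Stays (W.arrowAt τ' ω) b (z'.step c.2) s} := by
  have hmem : z ∈ levelSet z.1.2 (z.1.2 + 1) := ⟨le_rfl, lt_add_one _⟩
  have hmem' : z' ∈ levelSet z.1.2 (z.1.2 + 1) := ⟨hz.le, hz ▸ lt_add_one z.1.2⟩
  have hfirst : Measurable[W.siteSigma (levelSet z.1.2 (z.1.2 + 1))]
      fun ω => (W.arrowAt τ ω z, W.arrowAt τ' ω z') :=
    (W.measurable_siteSigma_arrowAt_apply hmem τ).prodMk
      (W.measurable_siteSigma_arrowAt_apply hmem' τ')
  have hrest : ∀ c : Bool × Bool,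
      MeasurableSet[W.siteSigma (levelSet (z.1.2 + 1) (z.1.2 + 1 + s))]
        {ω | Stays (W.arrowAt τ ω) b (z.step c.1) s ∧
          Stays (W.arrowAt τ' ω) b (z'.step c.2) s} := by
    intro c
    have hlevel : (z'.step c.2).1.2 = z.1.2 + 1 := congrArg (· + 1) hz.symm
    exact (W.measurableSet_stays_apply τ b subset_rfl).inter
      (W.measurableSet_stays_apply τ' b (by rw [hlevel]; exact subset_rfl))
  have hfiber : ∀ c : Bool × Bool,
      P.real ((fun ω => (W.arrowAt τ ω z, W.arrowAt τ' ω z')) ⁻¹' {c}) =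
      (1 + diagCorr ρ z z' * (increment c.1 * increment c.2)) / 4 := by
    rintro ⟨c, c'⟩
    rw [← W.measureReal_arrowAt_pair h z z' c c']
    simp [Set.preimage]
  simp only [stays_succ, hbz, hbz', true_and, ← hfiber]
  exact measureReal_mem_eq_sum_of_indep (W.siteSigma_le _) (W.siteSigma_le _)
    (W.indep_siteSigma (disjoint_levelSet le_rfl)) hfirst hrest

lemma measureReal_stays_pair (h : W.HasCorrelation τ τ' ρ) (hz : z.1.2 = z'.1.2) :
    P.real {ω | Stays (W.arrowAt τ ω) b z s ∧ Stays (W.arrowAt τ' ω) b z' s} =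
      pairStayProb ρ s (z.1.1 - b) (z'.1.1 - b) := by
  induction s generalizing z z' with
  | zero =>
    simp only [stays_zero, pairStayProb, sub_nonneg]
    split_ifs with hb <;> simp [hb]
  | succ s ih =>
    by_cases hb : b ≤ z.1.1 ∧ b ≤ z'.1.1
    · have hcorr : diagCorr ρ z z' = diagCorr ρ (z.1.1 - b) (z'.1.1 - b) := by
        have hiff : z = z' ↔ z.1.1 - b = z'.1.1 - b := by
          rw [sub_left_inj, Subtype.ext_iff, Prod.ext_iff, and_iff_left hz]
        simp only [diagCorr, hiff]
      have hstep : ∀ c c' : Bool, P.real {ω | Stays (W.arrowAt τ ω) b (z.step c) s ∧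
          Stays (W.arrowAt τ' ω) b (z'.step c') s} =
          pairStayProb ρ s (z.1.1 - b + increment c) (z'.1.1 - b + increment c') := by
        intro c c'
        rw [ih (congrArg (· + 1) hz)]
        simp only [EvenSite.step, followArrow, add_sub_right_comm]
      rw [W.measureReal_stays_pair_succ h hz hb.1 hb.2, hcorr,
        pairStayProb_succ s (sub_nonneg.2 hb.1) (sub_nonneg.2 hb.2)]
      simp only [Fintype.sum_prod_type, Fintype.sum_bool, hstep, increment, if_true,
        Bool.false_eq_true, if_false, ← sub_eq_add_neg]
      push_cast
      ring
    · have hempty : {ω | Stays (W.arrowAt τ ω) b z (s + 1) ∧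
          Stays (W.arrowAt τ' ω) b z' (s + 1)} = ∅ :=
        Set.eq_empty_of_forall_notMem fun ω hω =>
          hb ⟨(stays_succ.1 hω.1).1, (stays_succ.1 hω.2).1⟩
      rw [hempty, measureReal_empty, pairStayProb_of_neg _ (by simpa using hb)]

end Stays

end DynamicalDiscreteWeb

/-! ### Scales -/

/-- The time at which scale `k` starts: scale `j` lasts for `scaleSize j ^ 2` steps. -/
def startTime (k : ℕ) : ℕ := ∑ j ∈ Finset.range k, scaleSize j ^ 2

/-- The distance to the left of the origin at which scale `k` starts: scale `j` allows for a
descent by `4 * scaleSize j`. -/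
def startDepth (k : ℕ) : ℕ := ∑ j ∈ Finset.range k, 4 * scaleSize j

lemma startTime_succ (k : ℕ) : startTime (k + 1) = startTime k + scaleSize k ^ 2 :=
  Finset.sum_range_succ _ _

lemma startDepth_succ (k : ℕ) : startDepth (k + 1) = startDepth k + 4 * scaleSize k :=
  Finset.sum_range_succ _ _

lemma scaleSize_pos (k : ℕ) : 0 < scaleSize k := Nat.two_pow_pos _

lemma startTime_strictMono : StrictMono startTime :=
  strictMono_nat_of_lt_succ fun k => by
    rw [startTime_succ]
    exact Nat.lt_add_of_pos_right (pow_pos (scaleSize_pos k) 2)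

lemma startDepth_add_eight (k : ℕ) : startDepth k + 8 = 8 * 2 ^ k := by
  induction k with
  | zero => rfl
  | succ k ih =>
    rw [startDepth_succ, scaleSize, pow_succ]
    omega

lemma two_pow_sq_le_startTime_add_one (k : ℕ) : (2 ^ k) ^ 2 ≤ startTime k + 1 := by
  cases k with
  | zero => rfl
  | succ k =>
    rw [startTime_succ, scaleSize]
    omega

lemma exists_startTime_add (N : ℕ) : ∃ k, ∃ n < scaleSize k ^ 2, N = startTime k + n := by
  induction N with
  | zero => exact ⟨0, 0, pow_pos (scaleSize_pos 0) 2, rfl⟩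
  | succ N ih =>
    obtain ⟨k, n, hn, rfl⟩ := ih
    rcases (Nat.succ_le_of_lt hn).lt_or_eq with hlt | heq
    · exact ⟨k, n + 1, hlt, rfl⟩
    · exact ⟨k + 1, 0, pow_pos (scaleSize_pos _) 2, by rw [startTime_succ, ← heq]; rfl⟩

/-- The site from which the event of scale `k` is observed. -/
def scaleStart (k : ℕ) : EvenSite :=
  ⟨(-(startDepth k : ℤ), (startTime k : ℤ)), by
    have hsize : ∀ j, Even (scaleSize j) := fun j => even_two.pow_of_ne_zero j.succ_ne_zero
    have hdepth : Even (startDepth k) := Finset.even_sum _ fun j _ => (hsize j).mul_left 4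
    have htime : Even (startTime k) :=
      Finset.even_sum _ fun j _ => (hsize j).pow_of_ne_zero two_ne_zero
    exact ((Int.even_coe_nat _).2 hdepth).neg.add ((Int.even_coe_nat _).2 htime)⟩

/-- The event of scale `k`: during this scale, the path from `scaleStart k` does not pass to the
left of `scaleStart (k + 1)`. -/
def ScaleEvent (ξ : EvenSite → Bool) (k : ℕ) : Prop :=
  Stays ξ (-(startDepth (k + 1) : ℤ)) (scaleStart k) (scaleSize k ^ 2)

/-- The sites whose time coordinate belongs to scale `k`. -/
def scaleLevels (k : ℕ) : Set EvenSite := levelSet (startTime k) (startTime (k + 1))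

lemma pairwise_disjoint_scaleLevels : Pairwise (Function.onFun Disjoint scaleLevels) := by
  have hmono : Monotone fun k => (startTime k : ℤ) :=
    Nat.mono_cast.comp startTime_strictMono.monotone
  exact fun i j hij => (hmono.pairwise_disjoint_on_Ico_succ hij).preimage _

namespace DynamicalDiscreteWeb

variable {Ω : Type*} [MeasurableSpace Ω] {P : Measure Ω} (W : DynamicalDiscreteWeb P)

lemma measurableSet_scaleEvent {S : Set EvenSite} {k : ℕ} (hS : scaleLevels k ⊆ S) :
    MeasurableSet[Real.measurableSpace.prod (W.siteSigma S)]
      {p : ℝ × Ω | ScaleEvent (W.arrowAt p.1 p.2) k} := by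
  refine W.measurableSet_stays _ (subset_trans ?_ hS)
  rw [scaleLevels, startTime_succ, Nat.cast_add]
  exact subset_rfl

lemma measurableSet_scaleEvent_apply (τ : ℝ) (k : ℕ) :
    MeasurableSet[W.siteSigma (scaleLevels k)] {ω | ScaleEvent (W.arrowAt τ ω) k} :=
  @measurable_prodMk_left _ _ _ (W.siteSigma (scaleLevels k)) τ _
    (W.measurableSet_scaleEvent subset_rfl)

variable [IsProbabilityMeasure P]

lemma measureReal_scaleEvent_pair {τ τ' ρ : ℝ} (h : W.HasCorrelation τ τ' ρ) (k : ℕ) :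
    P.real {ω | ScaleEvent (W.arrowAt τ ω) k ∧ ScaleEvent (W.arrowAt τ' ω) k} =
      pairScaleProb ρ k := by
  have hstart : (scaleStart k).1.1 - -(startDepth (k + 1) : ℤ) = (4 * scaleSize k : ℕ) := by
    rw [startDepth_succ, scaleStart, Nat.cast_add]
    ring
  rw [pairScaleProb, ← hstart]
  exact W.measureReal_stays_pair h rfl

lemma measureReal_scaleEvent (τ : ℝ) (k : ℕ) :
    P.real {ω | ScaleEvent (W.arrowAt τ ω) k} = scaleProb k := by
  rw [← pairScaleProb_one, ← W.measureReal_scaleEvent_pair (W.hasCorrelation_self τ)]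
  simp only [and_self]

lemma measureReal_forall_scaleEvent_pair {τ τ' ρ : ℝ} (h : W.HasCorrelation τ τ' ρ) (n : ℕ) :
    P.real {ω | (∀ k < n, ScaleEvent (W.arrowAt τ ω) k) ∧
      ∀ k < n, ScaleEvent (W.arrowAt τ' ω) k} = ∏ k ∈ Finset.range n, pairScaleProb ρ k := by
  have hinter : {ω | (∀ k < n, ScaleEvent (W.arrowAt τ ω) k) ∧
      ∀ k < n, ScaleEvent (W.arrowAt τ' ω) k} = ⋂ k ∈ Finset.range n,
        {ω | ScaleEvent (W.arrowAt τ ω) k ∧ ScaleEvent (W.arrowAt τ' ω) k} := by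
    ext ω
    simp only [Set.mem_ofPred_eq, Set.mem_iInter, Finset.mem_range, forall_and]
  have hprod := (W.iIndep_siteSigma pairwise_disjoint_scaleLevels).meas_biInter
    (S := Finset.range n) fun k _ =>
      (W.measurableSet_scaleEvent_apply τ k).inter (W.measurableSet_scaleEvent_apply τ' k)
  rw [hinter, measureReal_def]
  refine (congrArg ENNReal.toReal hprod).trans ?_
  rw [ENNReal.toReal_prod]
  exact Finset.prod_congr rfl fun k _ => W.measureReal_scaleEvent_pair h k

lemma measureReal_forall_scaleEvent (τ : ℝ) (n : ℕ) :
    P.real {ω | ∀ k < n, ScaleEvent (W.arrowAt τ ω) k} = ∏ k ∈ Finset.range n, scaleProb k := by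
  simpa only [and_self, pairScaleProb_one] using
    W.measureReal_forall_scaleEvent_pair (W.hasCorrelation_self τ) n

lemma ae_frequently_not_scaleEvent (τ : ℝ) :
    ∀ᵐ ω ∂P, ∃ᶠ k in Filter.atTop, ¬ ScaleEvent (W.arrowAt τ ω) k := by
  obtain ⟨q, hq, hle⟩ := exists_eventually_scaleProb_le
  refine ae_frequently_notMem_of_iIndep (A := fun k => {ω | ScaleEvent (W.arrowAt τ ω) k})
    (fun k => W.siteSigma_le (scaleLevels k)) (W.iIndep_siteSigma pairwise_disjoint_scaleLevels)
    (W.measurableSet_scaleEvent_apply τ) (ENNReal.ofReal_lt_one.2 hq) (hle.mono fun k hk => ?_)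
  rw [← ofReal_measureReal, W.measureReal_scaleEvent]
  exact ENNReal.ofReal_le_ofReal hk

end DynamicalDiscreteWeb

/-! ### From the scale events to subdiffusivity -/

lemma isPlusSubdiffusive_linearInterpolation {s : ℕ → ℤ} {a K : ℝ} (ha : 0 ≤ a) (hK : 0 ≤ K)
    (hstep : ∀ n, s n - 1 ≤ s (n + 1)) (hs : ∀ n : ℕ, -a - K * √n ≤ s n) :
    IsPlusSubdiffusive K (linearInterpolation s) := by
  refine ⟨a + 1, by positivity, fun t ht => ?_⟩
  have hfloor : (⌊t⌋₊ : ℝ) ≤ t := Nat.floor_le ht.le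
  have hfrac : t - ⌊t⌋₊ ≤ 1 := by linarith [Nat.lt_floor_add_one t]
  have hincr : -1 ≤ (s (⌊t⌋₊ + 1) : ℝ) - s ⌊t⌋₊ := by
    have hcast : (s ⌊t⌋₊ : ℝ) - 1 ≤ s (⌊t⌋₊ + 1) := by exact_mod_cast hstep ⌊t⌋₊
    linarith
  have hinterp : -1 ≤ (t - ⌊t⌋₊) * ((s (⌊t⌋₊ + 1) : ℝ) - s ⌊t⌋₊) := by
    nlinarith [sub_nonneg.2 hfloor]
  have hsqrt : K * √(⌊t⌋₊ : ℝ) ≤ K * √t := by gcongr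
  rw [linearInterpolation]
  linarith [hs ⌊t⌋₊]

section WebPath

variable (ξ : EvenSite → Bool)

lemma iterate_followArrow_time (z : EvenSite) (n : ℕ) :
    ((followArrow ξ)^[n] z).1.2 = z.1.2 + n := by
  induction n with
  | zero => simp
  | succ n ih =>
    rw [Function.iterate_succ_apply', Nat.cast_succ, ← add_assoc, ← ih]
    rfl

lemma webPath_add (z : EvenSite) (m n : ℕ) :
    webPath ξ z (m + n) = webPath ξ ((followArrow ξ)^[m] z) n := by
  rw [webPath, add_comm, Function.iterate_add_apply, webPath]

lemma webPath_sub_one_le (z : EvenSite) (n : ℕ) : webPath ξ z n - 1 ≤ webPath ξ z (n + 1) := by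
  rw [webPath, webPath, Function.iterate_succ_apply']
  simp only [followArrow, increment]
  split_ifs <;> omega

/- Two paths cannot jump over each other, because the parity constraint makes the distance of two
sites at the same time even. -/
lemma webPath_mono {z z' : EvenSite} (htime : z.1.2 = z'.1.2) (hle : z.1.1 ≤ z'.1.1) (n : ℕ) :
    webPath ξ z n ≤ webPath ξ z' n := by
  induction n generalizing z z' with
  | zero => exact hle
  | succ n ih =>
    rw [webPath_succ, webPath_succ]
    refine ih (congrArg (· + 1) htime) ?_
    rcases hle.eq_or_lt with heq | hlt
    · rw [show z = z' from Subtype.ext (Prod.ext heq htime)]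
    · have hz := z.2
      have hz' := z'.2
      simp only [EvenSite.step, followArrow, increment]
      split_ifs <;> grind

end WebPath

section ScaleEvent

variable {ξ : EvenSite → Bool}

lemma ScaleEvent.neg_startDepth_le_webPath {k n : ℕ} (h : ScaleEvent ξ k)
    (hk : -(startDepth k : ℤ) ≤ webPath ξ EvenSite.origin (startTime k))
    (hn : n ≤ scaleSize k ^ 2) :
    -(startDepth (k + 1) : ℤ) ≤ webPath ξ EvenSite.origin (startTime k + n) := by
  rw [webPath_add]
  refine (h n hn).trans (webPath_mono ξ ?_ hk n)
  rw [iterate_followArrow_time]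
  simp [scaleStart, EvenSite.origin]

lemma neg_startDepth_le_webPath (h : ∀ k, ScaleEvent ξ k) (k : ℕ) :
    -(startDepth k : ℤ) ≤ webPath ξ EvenSite.origin (startTime k) := by
  induction k with
  | zero => exact le_rfl
  | succ k ih =>
    rw [startTime_succ]
    exact (h k).neg_startDepth_le_webPath ih le_rfl

lemma neg_sub_mul_sqrt_le_webPath (h : ∀ k, ScaleEvent ξ k) (N : ℕ) :
    -8 - 16 * √N ≤ (webPath ξ EvenSite.origin N : ℝ) := by
  obtain ⟨k, n, hn, rfl⟩ := exists_startTime_add N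
  have hpath : -(startDepth (k + 1) : ℝ) ≤ webPath ξ EvenSite.origin (startTime k + n) := by
    exact_mod_cast (h k).neg_startDepth_le_webPath (neg_startDepth_le_webPath h k) hn.le
  have hdepth : (startDepth (k + 1) : ℝ) + 8 = 16 * 2 ^ k := by
    rw [show (16 : ℝ) * 2 ^ k = 8 * 2 ^ (k + 1) by ring]
    exact_mod_cast startDepth_add_eight (k + 1)
  have hsize : (2 : ℝ) ^ k ≤ 1 + √(startTime k + n : ℕ) := by
    rw [← sq_le_sq₀ (by positivity) (by positivity)]
    have htime : ((2 : ℝ) ^ k) ^ 2 ≤ (startTime k + n : ℕ) + 1 := by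
      exact_mod_cast (two_pow_sq_le_startTime_add_one k).trans (by omega)
    nlinarith [Real.sq_sqrt ((startTime k + n : ℕ).cast_nonneg (α := ℝ)),
      Real.sqrt_nonneg (startTime k + n : ℕ)]
  linarith

lemma isPlusSubdiffusive_of_scaleEvent (h : ∀ k, ScaleEvent ξ k) {K : ℝ} (hK : 16 ≤ K) :
    IsPlusSubdiffusive K (linearInterpolation (webPath ξ EvenSite.origin)) := by
  refine isPlusSubdiffusive_linearInterpolation (a := 8) (by norm_num) (by linarith)
    (webPath_sub_one_le ξ _) fun N => ?_
  have hmul : 16 * √(N : ℝ) ≤ K * √N := by gcongr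
  linarith [neg_sub_mul_sqrt_le_webPath h N]

end ScaleEvent

/-! ### Compactness and the ring times -/

namespace DynamicalDiscreteWeb

open Filter Topology

section Compactness

variable {Ω : Type*} [MeasurableSpace Ω] {P : Measure Ω} {W : DynamicalDiscreteWeb P} {ω : Ω}
  {τ₀ : ℝ}

lemma GoodClock.eventually_arrowAt_eq {z : EvenSite} (h : W.GoodClock z ω)
    (hring : ∀ n, W.ringTime z n ω ≠ τ₀) :
    ∀ᶠ τ in 𝓝 τ₀, W.arrowAt τ ω z = W.arrowAt τ₀ ω z := by
  have hiff : ∀ᶠ τ in 𝓝 τ₀, ∀ n ∈ {n | W.ringTime z n ω ≤ τ₀ + 1},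
      (W.ringTime z n ω ≤ τ ↔ W.ringTime z n ω ≤ τ₀) := by
    rw [eventually_all_finite (h.finite_setOf_ringTime_le _)]
    intro n _
    rcases (hring n).lt_or_gt with hlt | hgt
    · filter_upwards [lt_mem_nhds hlt] with τ hτ using iff_of_true (le_of_lt hτ) hlt.le
    · filter_upwards [gt_mem_nhds hgt] with τ hτ using iff_of_false (not_le.2 hτ) (not_le.2 hgt)
  filter_upwards [hiff, gt_mem_nhds (lt_add_one τ₀)] with τ hτ hτlt
  have hset : {n | W.ringTime z n ω ≤ τ} = {n | W.ringTime z n ω ≤ τ₀} := by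
    ext n
    by_cases hn : W.ringTime z n ω ≤ τ₀ + 1
    · exact hτ n hn
    · exact iff_of_false (fun h => hn (h.trans (le_of_lt hτlt)))
        (fun h => hn (h.trans (lt_add_one τ₀).le))
  rw [arrowAt, arrowAt, ringCount, ringCount, hset]

lemma eventually_stays_iff {b : ℤ} {z : EvenSite} {s : ℕ}
    (h : ∀ z' : EvenSite, z.1.2 ≤ z'.1.2 →
      ∀ᶠ τ in 𝓝 τ₀, W.arrowAt τ ω z' = W.arrowAt τ₀ ω z') :
    ∀ᶠ τ in 𝓝 τ₀, (Stays (W.arrowAt τ ω) b z s ↔ Stays (W.arrowAt τ₀ ω) b z s) := by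
  induction s generalizing z with
  | zero => simp only [stays_zero, eventually_true]
  | succ s ih =>
    have hstep : ∀ᶠ τ in 𝓝 τ₀, (Stays (W.arrowAt τ ω) b (z.step (W.arrowAt τ₀ ω z)) s ↔
        Stays (W.arrowAt τ₀ ω) b (z.step (W.arrowAt τ₀ ω z)) s) :=
      ih fun z' hz' => h z' ((lt_add_one z.1.2).le.trans hz')
    filter_upwards [h z le_rfl, hstep] with τ harrow hstays
    rw [stays_succ, stays_succ, harrow, hstays]

lemma scaleEvent_of_tendsto (hclock : ∀ z, W.GoodClock z ω) {k : ℕ}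
    (hring : ∀ z : EvenSite, startTime k ≤ z.1.2 → ∀ n, W.ringTime z n ω ≠ τ₀) {τ : ℕ → ℝ}
    (hτ : Tendsto τ atTop (𝓝 τ₀)) (h : ∀ᶠ n in atTop, ScaleEvent (W.arrowAt (τ n) ω) k) :
    ScaleEvent (W.arrowAt τ₀ ω) k := by
  have hiff : ∀ᶠ τ in 𝓝 τ₀, (ScaleEvent (W.arrowAt τ ω) k ↔ ScaleEvent (W.arrowAt τ₀ ω) k) :=
    eventually_stays_iff fun z hz => (hclock z).eventually_arrowAt_eq (hring z hz)
  obtain ⟨n, hn, hevent⟩ := ((hτ.eventually hiff).and h).exists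
  exact hn.1 hevent

variable (W) in
/-- The ring times are good if no two sites ring simultaneously and, at each ring time, infinitely
many of the events of the scales fail. -/
structure GoodRings (ω : Ω) : Prop where
  ne : ∀ ⦃z z'⦄, z' ≠ z → ∀ n n', W.ringTime z' n' ω ≠ W.ringTime z n ω
  frequently : ∀ z n, ∃ᶠ k in atTop, ¬ ScaleEvent (W.arrowAt (W.ringTime z n ω) ω) k

/- A limit `τ₀` of times satisfying more and more of the events satisfies all of them if no site
rings at `τ₀`. If a site rings at `τ₀`, then no other site does, so `τ₀` still satisfies the events
of all scales that start after this site, which `GoodRings` excludes. -/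
lemma exists_forall_scaleEvent (hclock : ∀ z, W.GoodClock z ω) (hrings : W.GoodRings ω)
    (h : ∀ n, ∃ τ ∈ Set.Icc (0 : ℝ) 1, ∀ k < n, ScaleEvent (W.arrowAt τ ω) k) :
    ∃ τ ∈ Set.Icc (0 : ℝ) 1, ∀ k, ScaleEvent (W.arrowAt τ ω) k := by
  choose τ hτ hevent using h
  obtain ⟨τ₀, hτ₀, φ, hφ, hlim⟩ := isCompact_Icc.tendsto_subseq hτ
  have hevent' : ∀ k, ∀ᶠ n in atTop, ScaleEvent (W.arrowAt (τ (φ n)) ω) k := fun k =>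
    (hφ.tendsto_atTop.eventually_gt_atTop k).mono fun n hn => hevent (φ n) k hn
  by_cases hring : ∃ z n, W.ringTime z n ω = τ₀
  · obtain ⟨z, n, rfl⟩ := hring
    have hlarge : ∀ᶠ k in atTop, z.1.2.toNat < startTime k :=
      startTime_strictMono.tendsto_atTop.eventually_gt_atTop _
    refine absurd (hlarge.mono fun k hk => ?_) (hrings.frequently z n)
    refine not_not.2 (scaleEvent_of_tendsto hclock (fun z' hz' => hrings.ne ?_ n) hlim (hevent' k))
    rintro rfl
    omega
  · push Not at hring
    exact ⟨τ₀, hτ₀, fun k => scaleEvent_of_tendsto hclock (fun z _ => hring z) hlim (hevent' k)⟩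

end Compactness

section GoodRings

variable {Ω : Type*} [MeasurableSpace Ω] {P : Measure Ω} (W : DynamicalDiscreteWeb P)

lemma measurable_siteSigma_ringTime {S : Set EvenSite} {z : EvenSite} (hz : z ∈ S) (n : ℕ) :
    Measurable[W.siteSigma S] (W.ringTime z n) :=
  Finset.measurable_fun_sum _ fun i _ => W.measurable_siteSigma_wait hz i

variable [IsProbabilityMeasure P]

lemma measure_ringTime_eq (z : EvenSite) (n : ℕ) (t : ℝ) :
    P {ω | W.ringTime z n ω = t} = 0 := by
  have hsum : ∀ ω, W.ringTime z n ω = W.clock z n ω + W.wait z n ω := W.clock_succ z n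
  have hfiber : ∀ a, {ω | a + W.wait z n ω = t} = W.wait z n ⁻¹' {t - a} := fun a => by
    ext ω
    exact eq_sub_iff_add_eq'.symm
  simp only [hsum]
  refine (measure_prodMk_mem_eq_lintegral (W.measurable_clock z n) (W.measurable_wait z n)
    (W.indepFun_clock_wait z n) (D := {p | p.1 + p.2 = t})
    (measurableSet_eq_fun (measurable_fst.add measurable_snd) measurable_const)).trans ?_
  simp [hfiber, W.measure_wait_preimage, expMeasure_singleton]

lemma ae_ringTime_ne {z z' : EvenSite} (hz : z' ≠ z) (n n' : ℕ) :
    ∀ᵐ ω ∂P, W.ringTime z' n' ω ≠ W.ringTime z n ω := by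
  have hmeas : Measurable[Real.measurableSpace.prod (W.siteSigma {z}ᶜ)]
      fun p : ℝ × Ω => W.ringTime z' n' p.2 :=
    (W.measurable_siteSigma_ringTime (Set.mem_compl_singleton_iff.2 hz) n').comp measurable_snd
  rw [ae_iff]
  simp only [not_not]
  exact measure_graph_eq_zero (W.siteSigma_le {z}) (W.siteSigma_le {z}ᶜ)
    (W.indep_siteSigma disjoint_compl_right)
    (W.measurable_siteSigma_ringTime (Set.mem_singleton z) n)
    (measurableSet_eq_fun hmeas measurable_fst) (W.measure_ringTime_eq z' n')

/- The clock of `z` is independent of the sites at later times, hence of the events of all but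
finitely many scales: its ring times are no better than deterministic ones. -/
lemma ae_frequently_not_scaleEvent_ringTime (z : EvenSite) (n : ℕ) :
    ∀ᵐ ω ∂P, ∃ᶠ k in atTop, ¬ ScaleEvent (W.arrowAt (W.ringTime z n ω) ω) k := by
  obtain ⟨k₀, hk₀⟩ := (startTime_strictMono.tendsto_atTop.eventually_gt_atTop z.1.2.toNat).exists
  have hlevel : ∀ k, scaleLevels (k + k₀) ⊆ {z}ᶜ := by
    rintro k x hx rfl
    have hmono : startTime k₀ ≤ startTime (k + k₀) :=
      startTime_strictMono.monotone (Nat.le_add_left _ _)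
    have hstart : (startTime (k + k₀) : ℤ) ≤ x.1.2 := hx.1
    omega
  have hmeas : MeasurableSet[Real.measurableSpace.prod (W.siteSigma {z}ᶜ)]
      {p : ℝ × Ω | ∀ᶠ k in atTop, ScaleEvent (W.arrowAt p.1 p.2) (k + k₀)} := by
    simp only [eventually_atTop, Set.ofPred_exists, Set.ofPred_forall]
    exact .iUnion fun _ => .iInter fun k => .iInter fun _ => W.measurableSet_scaleEvent (hlevel k)
  have hshift : ∀ ξ, (∀ᶠ k in atTop, ScaleEvent ξ (k + k₀)) ↔ ∀ᶠ k in atTop, ScaleEvent ξ k := by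
    intro ξ
    rw [← eventually_map (m := (· + k₀)) (P := ScaleEvent ξ), map_add_atTop_eq_nat]
  simp only [ae_iff, not_frequently, not_not, ← hshift]
  refine measure_graph_eq_zero (W.siteSigma_le {z}) (W.siteSigma_le {z}ᶜ)
    (W.indep_siteSigma disjoint_compl_right)
    (W.measurable_siteSigma_ringTime (Set.mem_singleton z) n) hmeas fun τ => ?_
  simpa only [Set.mem_ofPred_eq, ae_iff, not_frequently, not_not, ← hshift] using
    W.ae_frequently_not_scaleEvent τ

lemma ae_goodRings : ∀ᵐ ω ∂P, W.GoodRings ω := by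
  have hne : ∀ᵐ ω ∂P, ∀ z z', z' ≠ z → ∀ n n', W.ringTime z' n' ω ≠ W.ringTime z n ω := by
    simp only [ae_all_iff]
    exact fun z z' hz n n' => W.ae_ringTime_ne hz n n'
  have hfrequently : ∀ᵐ ω ∂P, ∀ z n,
      ∃ᶠ k in atTop, ¬ ScaleEvent (W.arrowAt (W.ringTime z n ω) ω) k := by
    simp only [ae_all_iff]
    exact W.ae_frequently_not_scaleEvent_ringTime
  filter_upwards [hne, hfrequently] with ω h h' using ⟨h, h'⟩

end GoodRings

end DynamicalDiscreteWeb

/-! ### The second moment method -/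

section SecondMoment

lemma sq_lintegral_le_measure_ne_zero_mul {Ω : Type*} [MeasurableSpace Ω] {P : Measure Ω}
    {f : Ω → ENNReal} (hf : Measurable f) :
    (∫⁻ ω, f ω ∂P) ^ 2 ≤ P {ω | f ω ≠ 0} * ∫⁻ ω, f ω ^ 2 ∂P := by
  have hs : MeasurableSet {ω | f ω ≠ 0} := (hf (measurableSet_singleton 0)).compl
  have hmul : ∀ ω, (f * (Set.indicator {ω | f ω ≠ 0} 1 : Ω → ENNReal)) ω = f ω := fun ω => by
    by_cases hω : f ω = 0 <;> simp [hω]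
  have hindicator : ∀ ω, Set.indicator {ω | f ω ≠ 0} (1 : Ω → ENNReal) ω ^ (2 : ℝ) =
      Set.indicator {ω | f ω ≠ 0} 1 ω := fun ω => by
    by_cases hω : f ω = 0 <;> simp [hω]
  have hholder := ENNReal.lintegral_mul_le_Lp_mul_Lq P Real.HolderConjugate.two_two
    hf.aemeasurable (measurable_one.indicator hs).aemeasurable
  simp only [hmul, hindicator, lintegral_indicator_one hs, ENNReal.rpow_two] at hholder
  have hsq : ∀ x : ENNReal, (x ^ (1 / 2 : ℝ)) ^ 2 = x := fun x => by
    rw [one_div, ← ENNReal.rpow_two, ENNReal.rpow_inv_rpow two_ne_zero]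
  calc (∫⁻ ω, f ω ∂P) ^ 2
      ≤ ((∫⁻ ω, f ω ^ 2 ∂P) ^ (1 / 2 : ℝ) * P {ω | f ω ≠ 0} ^ (1 / 2 : ℝ)) ^ 2 :=
        pow_le_pow_left₀ zero_le hholder 2
    _ = P {ω | f ω ≠ 0} * ∫⁻ ω, f ω ^ 2 ∂P := by rw [mul_pow, hsq, hsq, mul_comm]

lemma one_le_measure_iInter_mul {Ω : Type*} [MeasurableSpace Ω] {P : Measure Ω}
    [IsFiniteMeasure P] {s : ℕ → Set Ω} (hs : ∀ n, MeasurableSet (s n)) (hanti : Antitone s)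
    {E : ENNReal} (hE : E ≠ ⊤) (h : ∀ n, 1 ≤ P (s n) * E) : 1 ≤ P (⋂ n, s n) * E :=
  ge_of_tendsto' (ENNReal.Tendsto.mul_const (tendsto_measure_iInter_atTop
    (fun n => (hs n).nullMeasurableSet) hanti ⟨0, measure_ne_top P _⟩) (.inr hE)) h

variable {α Ω : Type*} [MeasurableSpace α] [MeasurableSpace Ω] {ν : Measure α} {P : Measure Ω}
  {D : Set (α × Ω)}

lemma lintegral_measure_section_sq [SFinite ν] [SFinite P] (hD : MeasurableSet D) :
    ∫⁻ ω, ν ((·, ω) ⁻¹' D) ^ 2 ∂P =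
      ∫⁻ a, ∫⁻ a', P (Prod.mk a ⁻¹' D ∩ Prod.mk a' ⁻¹' D) ∂ν ∂ν := by
  let D₂ : Set ((α × α) × Ω) := {q | (q.1.1, q.2) ∈ D ∧ (q.1.2, q.2) ∈ D}
  have hD₂ : MeasurableSet D₂ :=
    (hD.preimage (by fun_prop : Measurable fun q : (α × α) × Ω => (q.1.1, q.2))).inter
      (hD.preimage (by fun_prop : Measurable fun q : (α × α) × Ω => (q.1.2, q.2)))
  calc ∫⁻ ω, ν ((·, ω) ⁻¹' D) ^ 2 ∂P
      = ∫⁻ ω, (ν.prod ν) (((·, ω) ⁻¹' D) ×ˢ ((·, ω) ⁻¹' D)) ∂P := by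
        simp only [Measure.prod_prod, sq]
    _ = ((ν.prod ν).prod P) D₂ := (Measure.prod_apply_symm hD₂).symm
    _ = ∫⁻ a, P (Prod.mk a ⁻¹' D₂) ∂ν.prod ν := Measure.prod_apply hD₂
    _ = ∫⁻ a, ∫⁻ a', P (Prod.mk a ⁻¹' D ∩ Prod.mk a' ⁻¹' D) ∂ν ∂ν :=
        lintegral_prod _ (measurable_measure_prodMk_left hD₂).aemeasurable

/- Second moment method for the size of a random set of constant density `p`, whose pair
correlations are controlled by a kernel `k` of energy at most `E`. -/
lemma one_le_measure_section_ne_zero_mul [IsProbabilityMeasure ν] [SFinite P]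
    (hD : MeasurableSet D) {p : ENNReal} (hp0 : p ≠ 0) (hptop : p ≠ ⊤)
    (hp : ∀ᵐ a ∂ν, P (Prod.mk a ⁻¹' D) = p) {k : α → α → ENNReal} {E : ENNReal}
    (hpair : ∀ᵐ a ∂ν, ∀ᵐ a' ∂ν, P (Prod.mk a ⁻¹' D ∩ Prod.mk a' ⁻¹' D) ≤ p ^ 2 * k a a')
    (hk : ∀ᵐ a ∂ν, ∫⁻ a', k a a' ∂ν ≤ E) :
    1 ≤ P {ω | ν ((·, ω) ⁻¹' D) ≠ 0} * E := by
  have hp2 : p ^ 2 ≠ ⊤ := ENNReal.pow_ne_top hptop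
  have hfirst : ∫⁻ ω, ν ((·, ω) ⁻¹' D) ∂P = p := by
    rw [← Measure.prod_apply_symm hD, Measure.prod_apply hD, lintegral_congr_ae hp]
    simp
  have hsecond : ∫⁻ ω, ν ((·, ω) ⁻¹' D) ^ 2 ∂P ≤ p ^ 2 * E := by
    calc ∫⁻ ω, ν ((·, ω) ⁻¹' D) ^ 2 ∂P
        = ∫⁻ a, ∫⁻ a', P (Prod.mk a ⁻¹' D ∩ Prod.mk a' ⁻¹' D) ∂ν ∂ν :=
          lintegral_measure_section_sq hD
      _ ≤ ∫⁻ _, p ^ 2 * E ∂ν := by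
          refine lintegral_mono_ae ?_
          filter_upwards [hpair, hk] with a hpair hk
          calc ∫⁻ a', P (Prod.mk a ⁻¹' D ∩ Prod.mk a' ⁻¹' D) ∂ν
              ≤ ∫⁻ a', p ^ 2 * k a a' ∂ν := lintegral_mono_ae hpair
            _ = p ^ 2 * ∫⁻ a', k a a' ∂ν := lintegral_const_mul' _ _ hp2
            _ ≤ p ^ 2 * E := by gcongr
      _ = p ^ 2 * E := by simp
  have hmoments : p ^ 2 ≤ P {ω | ν ((·, ω) ⁻¹' D) ≠ 0} * (p ^ 2 * E) := by
    calc p ^ 2 = (∫⁻ ω, ν ((·, ω) ⁻¹' D) ∂P) ^ 2 := by rw [hfirst]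
      _ ≤ P {ω | ν ((·, ω) ⁻¹' D) ≠ 0} * ∫⁻ ω, ν ((·, ω) ⁻¹' D) ^ 2 ∂P :=
          sq_lintegral_le_measure_ne_zero_mul (measurable_measure_prodMk_right hD)
      _ ≤ P {ω | ν ((·, ω) ⁻¹' D) ≠ 0} * (p ^ 2 * E) := by gcongr
  rw [mul_left_comm] at hmoments
  exact (ENNReal.mul_le_mul_iff_right (pow_ne_zero 2 hp0) hp2).1 (by rwa [mul_one])

end SecondMoment

lemma exists_lintegral_div_sqrt_abs_sub_le (C : ℝ) :
    ∃ E : ENNReal, E ≠ ⊤ ∧ ∀ τ ∈ Set.Icc (0 : ℝ) 1,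
      ∫⁻ τ' in Set.Icc 0 1, ENNReal.ofReal (C / √|τ - τ'|) ≤ E := by
  have hlocal : LocallyIntegrable fun u : ℝ => C / √|u| := by
    refine locallyIntegrable_of_norm_le_rpow (C := |C|) (α := 1 / 2) (by simp) (by norm_num) ?_
      (by fun_prop : Measurable fun u : ℝ => C / √|u|).aestronglyMeasurable
    refine .of_forall fun u => ?_
    rw [Real.norm_eq_abs, abs_div, abs_of_nonneg (Real.sqrt_nonneg _), Real.norm_eq_abs,
      Real.rpow_neg (abs_nonneg u), ← Real.sqrt_eq_rpow, div_eq_mul_inv]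
  refine ⟨∫⁻ u in Set.Icc (-1) 1, ENNReal.ofReal (C / √|u|),
    (hlocal.integrableOn_isCompact isCompact_Icc).lintegral_lt_top.ne, fun τ hτ => ?_⟩
  calc ∫⁻ τ' in Set.Icc 0 1, ENNReal.ofReal (C / √|τ - τ'|)
      ≤ ∫⁻ τ', (Set.Icc (-1) 1).indicator (fun u => ENNReal.ofReal (C / √|u|)) (τ - τ') := by
        rw [← lintegral_indicator measurableSet_Icc]
        refine lintegral_mono (Set.indicator_le fun τ' hτ' => ?_)
        have hdiff : τ - τ' ∈ Set.Icc (-1 : ℝ) 1 :=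
          ⟨by linarith [hτ.1, hτ'.2], by linarith [hτ.2, hτ'.1]⟩
        rw [Set.indicator_of_mem hdiff]
    _ = ∫⁻ u in Set.Icc (-1) 1, ENNReal.ofReal (C / √|u|) := by
        rw [lintegral_sub_left_eq_self, lintegral_indicator measurableSet_Icc]

/-! ### Exceptional times -/

namespace DynamicalDiscreteWeb

variable {Ω : Type*} [MeasurableSpace Ω] {P : Measure Ω} (W : DynamicalDiscreteWeb P)

/-- The dynamical times and outcomes for which the events of the first `n` scales occur. -/
def scaleSet (n : ℕ) : Set (ℝ × Ω) := {p | ∀ k < n, ScaleEvent (W.arrowAt p.1 p.2) k}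

lemma measurableSet_scaleSet (n : ℕ) : MeasurableSet (W.scaleSet n) := by
  have hle : Real.measurableSpace.prod (W.siteSigma Set.univ) ≤ Prod.instMeasurableSpace :=
    sup_le_sup le_rfl (MeasurableSpace.comap_mono (W.siteSigma_le _))
  simp only [scaleSet, Set.ofPred_forall]
  exact .iInter fun k => .iInter fun _ => hle _ (W.measurableSet_scaleEvent (Set.subset_univ _))

/-- The outcomes for which the events of the first `n` scales occur simultaneously at a set of
positive length of dynamical times in `[0, 1]`. -/
def positiveTimeEvent (n : ℕ) : Set Ω :=
  {ω | volume.restrict (Set.Icc (0 : ℝ) 1) ((·, ω) ⁻¹' W.scaleSet n) ≠ 0}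

lemma measurableSet_positiveTimeEvent (n : ℕ) : MeasurableSet (W.positiveTimeEvent n) :=
  (measurable_measure_prodMk_right (W.measurableSet_scaleSet n) (measurableSet_singleton 0)).compl

lemma antitone_positiveTimeEvent : Antitone W.positiveTimeEvent := fun m n hmn ω hω hzero => by
  have hsub : (·, ω) ⁻¹' W.scaleSet n ⊆ (·, ω) ⁻¹' W.scaleSet m :=
    fun _ hτ k hk => hτ k (lt_of_lt_of_le hk hmn)
  exact hω (measure_mono_null hsub hzero)

lemma exists_scaleEvent_of_mem_positiveTimeEvent {n : ℕ} {ω : Ω}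
    (hω : ω ∈ W.positiveTimeEvent n) :
    ∃ τ ∈ Set.Icc (0 : ℝ) 1, ∀ k < n, ScaleEvent (W.arrowAt τ ω) k := by
  by_contra! h
  refine hω ((Measure.restrict_apply_eq_zero' measurableSet_Icc).2 ?_)
  have hempty : (·, ω) ⁻¹' W.scaleSet n ∩ Set.Icc (0 : ℝ) 1 = ∅ := by
    refine Set.eq_empty_of_forall_notMem fun τ hτ => ?_
    obtain ⟨k, hk, hfail⟩ := h τ hτ.2
    exact hfail (hτ.1 k hk)
  rw [hempty, measure_empty]

variable [IsProbabilityMeasure P]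

lemma measure_scaleSet (τ : ℝ) (n : ℕ) :
    P (Prod.mk τ ⁻¹' W.scaleSet n) = ENNReal.ofReal (∏ k ∈ Finset.range n, scaleProb k) := by
  rw [← W.measureReal_forall_scaleEvent τ, ofReal_measureReal]
  rfl

lemma exists_measure_scaleSet_inter_le :
    ∃ C : ℝ, ∀ τ ∈ Set.Icc (0 : ℝ) 1, ∀ τ' ∈ Set.Icc (0 : ℝ) 1, τ' ≠ τ → ∀ n,
      P (Prod.mk τ ⁻¹' W.scaleSet n ∩ Prod.mk τ' ⁻¹' W.scaleSet n) ≤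
        ENNReal.ofReal (∏ k ∈ Finset.range n, scaleProb k) ^ 2 *
          ENNReal.ofReal (C / √|τ - τ'|) := by
  obtain ⟨C, hle⟩ := exists_prod_pairScaleProb_le
  refine ⟨C, fun τ hτ τ' hτ' hne n => ?_⟩
  have hprod : 0 ≤ ∏ k ∈ Finset.range n, scaleProb k :=
    Finset.prod_nonneg fun k _ => stayProb_nonneg _ _
  have hdist : |τ - τ'| ≤ 1 :=
    abs_le.2 ⟨by linarith [hτ.1, hτ'.2], by linarith [hτ.2, hτ'.1]⟩
  have hreal : P.real (Prod.mk τ ⁻¹' W.scaleSet n ∩ Prod.mk τ' ⁻¹' W.scaleSet n) =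
      ∏ k ∈ Finset.range n, pairScaleProb (Real.exp (-|τ - τ'|)) k :=
    W.measureReal_forall_scaleEvent_pair (W.hasCorrelation_exp hτ.1 hτ'.1) n
  rw [← ofReal_measureReal, hreal, ← ENNReal.ofReal_pow hprod,
    ← ENNReal.ofReal_mul (pow_nonneg hprod 2), mul_comm]
  exact ENNReal.ofReal_le_ofReal (hle _ (abs_pos.2 (sub_ne_zero.2 hne.symm)) hdist n)

lemma exists_one_le_measure_positiveTimeEvent_mul :
    ∃ E : ENNReal, E ≠ ⊤ ∧ ∀ n, 1 ≤ P (W.positiveTimeEvent n) * E := by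
  obtain ⟨C, hpair⟩ := W.exists_measure_scaleSet_inter_le
  obtain ⟨E, hE, henergy⟩ := exists_lintegral_div_sqrt_abs_sub_le C
  have hν : IsProbabilityMeasure (volume.restrict (Set.Icc (0 : ℝ) 1)) := ⟨by simp⟩
  have hmem : ∀ᵐ τ ∂volume.restrict (Set.Icc (0 : ℝ) 1), τ ∈ Set.Icc (0 : ℝ) 1 :=
    ae_restrict_mem measurableSet_Icc
  have hne : ∀ τ, ∀ᵐ τ' ∂volume.restrict (Set.Icc (0 : ℝ) 1), τ' ≠ τ := fun τ =>
    ae_restrict_of_ae (Measure.ae_ne volume τ)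
  have hpos : ∀ n, 0 < ∏ k ∈ Finset.range n, scaleProb k := fun n =>
    Finset.prod_pos fun k _ => lt_of_lt_of_le (by norm_num) (le_stayProb_sq (scaleSize k))
  refine ⟨E, hE, fun n => one_le_measure_section_ne_zero_mul (W.measurableSet_scaleSet n)
    (ENNReal.ofReal_pos.2 (hpos n)).ne' ENNReal.ofReal_ne_top
    (.of_forall fun τ => W.measure_scaleSet τ n) ?_ (hmem.mono henergy)⟩
  filter_upwards [hmem] with τ hτ
  filter_upwards [hmem, hne τ] with τ' hτ' hne
  exact hpair τ hτ τ' hτ' hne n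

lemma measure_iInter_positiveTimeEvent_pos : 0 < P (⋂ n, W.positiveTimeEvent n) := by
  obtain ⟨E, hE, hle⟩ := W.exists_one_le_measure_positiveTimeEvent_mul
  have hmul := one_le_measure_iInter_mul W.measurableSet_positiveTimeEvent
    W.antitone_positiveTimeEvent hE hle
  exact pos_iff_ne_zero.2 (left_ne_zero_of_mul (zero_lt_one.trans_le hmul).ne')

end DynamicalDiscreteWeb

/-- For all `K` large enough, with positive probability there is a dynamical time `τ ∈ [0, 1]`
at which `S_0^τ` is `K⁺`-subdiffusive. Positivity is asserted for a measurable event `A` contained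
in the (uncountable) union over `τ`, so it does not depend on measurability of that union. -/
theorem proposition3 :
    ∃ K₀ : ℝ, 0 < K₀ ∧ ∀ K : ℝ, K₀ ≤ K →
      ∀ (Ω : Type*) [MeasurableSpace Ω] (P : Measure Ω) [IsProbabilityMeasure P]
        (W : DynamicalDiscreteWeb P),
        ∃ A : Set Ω, MeasurableSet A ∧ 0 < P A ∧
          A ⊆ {ω | ∃ τ ∈ Set.Icc (0 : ℝ) 1, IsPlusSubdiffusive K (W.originPath τ ω)} := by
  refine ⟨16, by norm_num, fun K hK Ω _ P _ W => ?_⟩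
  obtain ⟨N, hgood, hN, hN0⟩ :=
    exists_measurable_superset_of_null (ae_iff.1 (W.ae_goodClock.and W.ae_goodRings))
  refine ⟨(⋂ n, W.positiveTimeEvent n) \ N,
    (MeasurableSet.iInter W.measurableSet_positiveTimeEvent).diff hN, ?_, fun ω hω => ?_⟩
  · rw [measure_sdiff_null hN0]
    exact W.measure_iInter_positiveTimeEvent_pos
  · obtain ⟨hclock, hrings⟩ := not_not.1 fun hbad => hω.2 (hgood hbad)
    obtain ⟨τ, hτ, hevent⟩ := DynamicalDiscreteWeb.exists_forall_scaleEvent hclock hrings fun n =>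
      W.exists_scaleEvent_of_mem_positiveTimeEvent (Set.mem_iInter.1 hω.1 n)
    exact ⟨τ, hτ, isPlusSubdiffusive_of_scaleEvent hevent hK⟩
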